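/- **Proposition.** *Trees.* Let $\mathcal T$ be the set of (non-planar, undecorated) rooted trees and $\mathcal H_{\mathrm{BCK}}^*=\mathrm{Span}_{\mathbb R}(\mathcal F)$ the span of forests (finite multisets of rooted trees), with forest product $\odot$ and empty forest $\mathbf 1$. Let $\Delta_{\mathrm{sh}}$ be the unshuffle coproduct: it is multiplicative for $\odot$ and $\Delta_{\mathrm{sh}}\tau=\tau\otimes\mathbf 1+\mathbf 1\otimes\tau$ for $\tau\in\mathcal T$. For forests $\mathfrak f=\sigma_1\odot\cdots\odot\sigma_n$ and $\mathfrak g$, let $\mathfrak f\,\bar\star\,\mathfrak g$ be the sum, over all maps $v$ from $\{1,\dots,n\}$ to the vertices of $\mathfrak g$, of the forests obtained by joining the root of each $\sigma_i$ by an edge to $v(i)$, and let $\star_{\mathrm{BCK}}$ be the Grossman–Larson product $\mathfrak f\star_{\mathrm{BCK}}\mathfrak g=m_\odot(\mathrm{id}\otimes(\cdot\,\bar\star\,\mathfrak g))\Delta_{\mathrm{sh}}\mathfrak f$, where $m_\odot(a\otimes b)=a\odot b$. Let $B_+(\tau_1,\dots,\tau_n)$ be the tree obtained by joining the roots of $\tau_1,\dots,\tau_n$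 to a new root. For smooth $f:\mathbb R\to\mathbb R$ put $\Upsilon_f[B_+(\tau_1,\dots,\tau_n)]=f^{(n)}\prod_{i=1}^n\Upsilon_f[\tau_i]$ (so $\Upsilon_f[\bullet]=f$). *Multi-indices.* Let $\mathcal M$ be the set of populated multi-indices, i.e. monomials $z^\beta=\prod_{k\in\mathbb N}z_k^{\beta(k)}$ with $\beta:\mathbb N\to\mathbb N$ finitely supported and $\sum_k(1-k)\beta(k)=1$, and let $\mathcal H_{\mathbf M}$ be the span of forests (finite multisets) of populated multi-indices, with forest product $\cdot$ and empty forest $\mathbf 1$. Put $|z^\beta|=\sum_k\beta(k)$, $S(z^\beta)=\prod_k(k!)^{\beta(k)}$, and, for a forest $F$ in which the distinct $z^{\beta_i}$ occur $r_i$ times, $|F|=\sum_i r_i|z^{\beta_i}|$, $S(F)=\prod_i r_i!\,S(z^{\beta_i})^{r_i}$, $S_{\mathrm{ext}}(F)=\prod_i r_i!$. Let $\langle F,G\rangle=S(F)\,\delta_{F,G}$. The coproduct $\Delta^{\mathbf M}$ is multiplicative for $\cdot$, with $$\Delta^{\mathbf M}z^\beta=\mathbf 1\otimes z^\beta+z^\beta\otimes\mathbf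 1+\sum\frac{1}{S_{\mathrm{ext}}(F)}\,F\otimes\bar D^{\,n}z^{\hat\beta},\qquad \bar Dz^{\hat\beta}=\sum_{k\ge1}k\,\frac{\hat\beta(k-1)+1}{\hat\beta(k)}\,z_{k-1}\partial_{z_k}z^{\hat\beta},$$ where the sum runs over the non-empty forests $F$ of populated multi-indices $z^{\beta_1},\dots,z^{\beta_n}$ ($n\ge1$, unordered) such that $\beta=\beta_1+\cdots+\beta_n+\hat\beta$ for some $\hat\beta:\mathbb N\to\mathbb N$, and terms with $\hat\beta(k)=0$ are zero. Identify the graded dual (grading $|\cdot|$) $\mathcal H_{\mathbf M}^*$ with the span of forests of populated multi-indices through $\langle\cdot,\cdot\rangle$; let $\star_{\mathbf M}$ be its product dual to $\Delta^{\mathbf M}$ (for forests $F,G$, $F\star_{\mathbf M}G=\sum_{|K|=|F|+|G|}\frac{\langle F\otimes G,\Delta^{\mathbf M}K\rangle}{S(K)}K$) and $\Delta_{\cdot}$ the unshuffle coproduct, for which every $z^\beta\in\mathcal M$ is primitive. Let $\Phi:\mathcal T\to\mathcal M$, $\Phi(B_+(\tau_1,\dots,\tau_n))=z_n\prod_{i}\Phi(\tau_i)$,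 and extend $\Phi$ linearly and multiplicatively (from $\odot$ to $\cdot$) to $\mathcal H^*_{\mathrm{BCK}}\to\mathcal H^*_{\mathbf M}$. For smooth $f,\varphi:\mathbb R\to\mathbb R$ let $\bar\Upsilon_f[z^\beta]=\prod_{k}(f^{(k)})^{\beta(k)}$, let $\bar\Upsilon_f[z^{\beta_1}\cdots z^{\beta_n}]\{\varphi\}=\big(\prod_{i=1}^n\bar\Upsilon_f[z^{\beta_i}]\big)\varphi^{(n)}$, extended linearly, and $\bar\Upsilon_f[u\otimes v]\{\varphi\otimes\psi\}=\bar\Upsilon_f[u]\{\varphi\}\,\bar\Upsilon_f[v]\{\psi\}$. Then the multi-indices Hopf algebra satisfies the algebraic flow condition. More precisely: 1. $\star_{\mathbf M}$ and $\Delta_{\cdot}$ are the duals of $\Delta^{\mathbf M}$ and of the forest product: $\langle u\star_{\mathbf M}v,h\rangle=\langle u\otimes v,\Delta^{\mathbf M}h\rangle$ and $\langle\Delta_{\cdot}u,h\otimes k\rangle=\langle u,h\cdot k\rangle$. 2. $\Phi:(\mathcal H^*_{\mathrm{BCK}},\star_{\mathrm{BCK}},\Delta_{\mathrm{sh}})\to(\mathcal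 H^*_{\mathbf M},\star_{\mathbf M},\Delta_{\cdot})$ is a morphism: it preserves the unit, the product, the counit (the coefficient of the empty forest) and the coproduct. 3. For every smooth $f:\mathbb R\to\mathbb R$ and every $\tau\in\mathcal T$, $\bar\Upsilon_f[\Phi(\tau)]=\Upsilon_f[\tau]$. 4. For every smooth $f,\varphi,\psi:\mathbb R\to\mathbb R$ and all $u,v\in\mathcal H^*_{\mathbf M}$, the function $\bar\Upsilon_f[u]\{\varphi\}$ is smooth and $$\bar\Upsilon_f[u\star_{\mathbf M}v]\{\varphi\}=\bar\Upsilon_f[u]\big\{\bar\Upsilon_f[v]\{\varphi\}\big\},\qquad \bar\Upsilon_f[\Delta_{\cdot}u]\{\varphi\otimes\psi\}=\bar\Upsilon_f[u]\{\varphi\psi\}.$$ -/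

import Mathlib

open scoped TensorProduct ContDiff

namespace MultiIndexFlow

noncomputable section

open Classical

/-! ### Rooted trees -/

/-- Planar rooted trees. `bullet` is the one-vertex tree and `adjoin a t` is the tree obtained from
`t` by adding a new leftmost branch `a` at the root of `t`; every planar rooted tree arises in a
unique way from these two constructors. -/
inductive PlanarTree : Type
  | bullet : PlanarTree
  | adjoin (a t : PlanarTree) : PlanarTree

/-- An elementary change of planar structure: two neighbouring branches at some vertex are
exchanged. -/
inductive PlanarTree.Step : PlanarTree → PlanarTree → Prop
  | swap (a b t : PlanarTree) : Step (.adjoin a (.adjoin b t)) (.adjoin b (.adjoin a t))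
  | left {a a' : PlanarTree} (t : PlanarTree) : Step a a' → Step (.adjoin a t) (.adjoin a' t)
  | right (a : PlanarTree) {t t' : PlanarTree} : Step t t' → Step (.adjoin a t) (.adjoin a t')

/-- Non-planar rooted trees: planar rooted trees up to reordering the branches at the vertices. -/
def RTree : Type := Quot PlanarTree.Step

/-- The rooted tree underlying a planar rooted tree. -/
def RTree.mk (t : PlanarTree) : RTree := Quot.mk _ t

/-- The tree with one vertex. -/
def RTree.bullet : RTree := Quot.mk _ PlanarTree.bullet

/-- `a.adjoin t` is the tree `t` with one more branch `a` at its root. -/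
def RTree.adjoin (a t : RTree) : RTree :=
  Quot.map₂ PlanarTree.adjoin (fun a _ _ h => .right a h) (fun _ _ t h => .left t h) a t

instance : LeftCommutative RTree.adjoin :=
  ⟨fun a b t => by
    induction a using Quot.ind with | _ a =>
    induction b using Quot.ind with | _ b =>
    induction t using Quot.ind with | _ t =>
    exact Quot.sound (.swap a b t)⟩

/-- `B₊`: all the trees of a forest are connected to a new common root. -/
def RTree.bplus (s : Multiset RTree) : RTree := s.foldr RTree.adjoin RTree.bullet

/-! ### The dual of the Butcher–Connes–Kreimer Hopf algebra -/

/-- The span of forests of rooted trees. A forest is a monomial in the trees, the forest product is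
the product of polynomials and the empty forest is `1`. -/
abbrev HBCK : Type := MvPolynomial RTree ℝ

/-- The unshuffle coproduct on the symmetric algebra with basis `σ` of its degree one part: the
elements of `σ` are primitive and the coproduct is multiplicative for the forest product. -/
def unshuffle (σ : Type) : MvPolynomial σ ℝ →ₐ[ℝ] MvPolynomial σ ℝ ⊗[ℝ] MvPolynomial σ ℝ :=
  MvPolynomial.aeval fun i => MvPolynomial.X i ⊗ₜ 1 + 1 ⊗ₜ MvPolynomial.X i

/-- The vertices of a planar tree. The root of `adjoin a t` is the root of `t`. -/
def PlanarTree.Vertex : PlanarTree → Type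
  | .bullet => Unit
  | .adjoin a t => a.Vertex ⊕ t.Vertex

@[reducible]
def PlanarTree.vertexFintype : (t : PlanarTree) → Fintype t.Vertex
  | .bullet => inferInstanceAs (Fintype Unit)
  | .adjoin a t =>
    letI := a.vertexFintype
    letI := t.vertexFintype
    inferInstanceAs (Fintype (a.Vertex ⊕ t.Vertex))

instance (t : PlanarTree) : Fintype t.Vertex := t.vertexFintype

/-- `t.attach h` is the tree obtained from `t` by connecting, for every vertex `v` of `t`, the roots
of all the trees of the forest `h v` to `v`. -/
def PlanarTree.attach : (t : PlanarTree) → (t.Vertex → Multiset RTree) → RTree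
  | .bullet, h => RTree.bplus (h ())
  | .adjoin a t, h =>
    (a.attach fun v => h (Sum.inl v)).adjoin (t.attach fun v => h (Sum.inr v))

/-- Simultaneous grafting of a forest with trees `σ i`, `i ∈ ι`, onto a forest with trees `τ j`,
`j ∈ κ`: the sum over all the maps `v` from `ι` to the vertices of the second forest of the forest
obtained by connecting the root of `σ i` to the vertex `v i` for every `i`. -/
def simGraft {ι κ : Type} [Fintype ι] [Fintype κ] (σ : ι → RTree) (τ : κ → PlanarTree) : HBCK :=
  ∑ v : ι → Σ j, (τ j).Vertex,
    ∏ j, MvPolynomial.X ((τ j).attach fun w => (Finset.univ.filter (v · = ⟨j, w⟩)).val.map σ)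

/-- Planar representatives of the same tree give the same graftings. -/
theorem PlanarTree.attach_congr {t t' : PlanarTree}
    (h : (Quot.mk _ t : RTree) = Quot.mk _ t') :
    ∃ e : t.Vertex ≃ t'.Vertex, ∀ g, t.attach g = t'.attach fun v => g (e.symm v) := by
  have key : ∀ {t t' : PlanarTree}, PlanarTree.Step t t' →
      ∃ e : t.Vertex ≃ t'.Vertex, ∀ g, t.attach g = t'.attach fun v => g (e.symm v) := by
    intro t t' h
    induction h with
    | swap a b t =>
      refine ⟨(Equiv.sumAssoc a.Vertex b.Vertex t.Vertex).symm.trans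
        (((Equiv.sumComm a.Vertex b.Vertex).sumCongr (Equiv.refl _)).trans
          (Equiv.sumAssoc b.Vertex a.Vertex t.Vertex)), fun g => ?_⟩
      exact LeftCommutative.left_comm (op := RTree.adjoin) _ _ _
    | left t _ ih =>
      obtain ⟨e, he⟩ := ih
      exact ⟨e.sumCongr (Equiv.refl _),
        fun g => congrArg (fun x => RTree.adjoin x (t.attach fun v => g (Sum.inr v))) (he _)⟩
    | right a _ ih =>
      obtain ⟨e, he⟩ := ih
      exact ⟨(Equiv.refl _).sumCongr e,
        fun g => congrArg (RTree.adjoin (a.attach fun v => g (Sum.inl v))) (he _)⟩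
  replace h := Quot.eqvGen_exact h
  induction h with
  | rel _ _ h => exact key h
  | refl _ => exact ⟨Equiv.refl _, fun _ => rfl⟩
  | symm _ _ _ ih =>
    obtain ⟨e, he⟩ := ih
    exact ⟨e.symm, fun g => by rw [he]; simp⟩
  | trans _ _ _ _ _ ih₁ ih₂ =>
    obtain ⟨e₁, he₁⟩ := ih₁
    obtain ⟨e₂, he₂⟩ := ih₂
    exact ⟨e₁.trans e₂, fun g => by rw [he₁, he₂]; rfl⟩

/-- Simultaneous grafting does not depend on the planar representatives. -/
theorem simGraft_congr {ι κ : Type} [Fintype ι] [Fintype κ] (σ : ι → RTree)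
    {τ τ' : κ → PlanarTree} (h : ∀ j, (Quot.mk _ (τ j) : RTree) = Quot.mk _ (τ' j)) :
    simGraft σ τ = simGraft σ τ' := by
  choose e he using fun j => PlanarTree.attach_congr (h j)
  refine Fintype.sum_equiv ((Equiv.refl ι).arrowCongr (Equiv.sigmaCongrRight e)) _ _ fun v => ?_
  refine Finset.prod_congr rfl fun j _ => ?_
  rw [he j]
  congr 2
  funext w
  congr 2
  ext i
  simp only [Finset.mem_filter, Finset.mem_univ, true_and]
  rw [← (Equiv.sigmaCongrRight e).apply_eq_iff_eq]
  simp [Equiv.sigmaCongrRight_apply]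

/-- The bilinear extension of simultaneous grafting to linear combinations of forests. -/
def graftBCK : HBCK →ₗ[ℝ] HBCK →ₗ[ℝ] HBCK :=
  (MvPolynomial.basisMonomials RTree ℝ).constr ℝ fun F =>
    (MvPolynomial.basisMonomials RTree ℝ).constr ℝ fun G =>
      simGraft (fun i : Finsupp.toMultiset F => i.1) (fun j : Finsupp.toMultiset G => Quot.out j.1)

/-- The Grossman–Larson product: the forest `u` is split into two parts in all possible ways, one
part is kept aside and the other one is simultaneously grafted onto `v`. -/
def starBCK (u v : HBCK) : HBCK :=
  LinearMap.mul' ℝ HBCK (TensorProduct.map LinearMap.id (graftBCK.flip v) (unshuffle RTree u))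

/-! ### The Hopf algebra of multi-indices -/

/-- The population condition `∑ₖ (1 - k) β(k) = 1`. -/
def Populated (β : ℕ →₀ ℕ) : Prop := β.sum (fun k b => (1 - (k : ℤ)) * (b : ℤ)) = 1

/-- Populated multi-indices `z^β`. -/
abbrev PopMI : Type := {β : ℕ →₀ ℕ // Populated β}

/-- The norm `|z^β| = ∑ₖ β(k)`. -/
def miNorm (β : ℕ →₀ ℕ) : ℕ := β.sum fun _ b => b

/-- The symmetry factor `∏ₖ (k!)^β(k)` of a multi-index. -/
def symMI (β : ℕ →₀ ℕ) : ℕ := β.prod fun k b => k.factorial ^ b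

/-- Forests of populated multi-indices: `F β` is the number of occurrences of `z^β`. -/
abbrev ForestMI : Type := PopMI →₀ ℕ

/-- The span of forests of populated multi-indices; the forest product is the product of
polynomials in the populated multi-indices and the empty forest is `1`. -/
abbrev HM : Type := MvPolynomial PopMI ℝ

/-- The number of multi-indices in a forest. -/
def ForestMI.card (F : ForestMI) : ℕ := F.sum fun _ r => r

/-- The sum of all the multi-indices in a forest. -/
def ForestMI.total (F : ForestMI) : ℕ →₀ ℕ := F.sum fun β r => r • β.1

/-- The norm of a forest. -/
def ForestMI.norm (F : ForestMI) : ℕ := F.sum fun β r => r * miNorm β.1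

/-- The symmetry factor `∏ᵢ rᵢ! S(z^βᵢ)^rᵢ` of a forest. -/
def ForestMI.sym (F : ForestMI) : ℕ := F.prod fun β r => r.factorial * symMI β.1 ^ r

/-- The external symmetry factor `∏ᵢ rᵢ!` of a forest. -/
def ForestMI.symExt (F : ForestMI) : ℕ := F.prod fun _ r => r.factorial

/-- The map `D̄ z^β = ∑_{k ≥ 1} k (β(k-1) + 1) / β(k) z_{k-1} ∂_{z_k} z^β` on polynomials in the
variables `z_k`. -/
def Dbar : MvPolynomial ℕ ℝ →ₗ[ℝ] MvPolynomial ℕ ℝ :=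
  (MvPolynomial.basisMonomials ℕ ℝ).constr ℝ fun β =>
    ∑ k ∈ β.support.filter (0 < ·),
      ((k : ℝ) * ((β (k - 1) : ℝ) + 1) / (β k : ℝ)) •
        (MvPolynomial.X (k - 1) * MvPolynomial.pderiv k (MvPolynomial.monomial β (1 : ℝ)))

/-- A linear combination of populated multi-indices, seen as a polynomial in the variables `z_k`, is
turned into the same linear combination of forests with one element. -/
def toHM : MvPolynomial ℕ ℝ →ₗ[ℝ] HM :=
  (MvPolynomial.basisMonomials ℕ ℝ).constr ℝ fun β =>
    if h : Populated β then MvPolynomial.X (⟨β, h⟩ : PopMI) else 0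

theorem PopMI.norm_pos (β : PopMI) : 0 < miNorm β.1 := by
  rcases Nat.eq_zero_or_pos (miNorm β.1) with h | h
  · have h0 : β.1 = 0 := by
      ext k
      by_contra hk
      have := Finset.single_le_sum (f := fun k => β.1 k) (fun _ _ => Nat.zero_le _)
        (Finsupp.mem_support_iff.2 hk)
      simp only [miNorm, Finsupp.sum] at h
      simp only [Finsupp.coe_zero, Pi.zero_apply] at hk
      omega
    have := β.2
    simp [h0, Populated] at this
  · exact h

theorem ForestMI.finite_of_le (s : Finset PopMI) (n : ℕ) (S : Set ForestMI)
    (h : ∀ F ∈ S, ∀ β, F β ≠ 0 → β ∈ s ∧ F β ≤ n) : S.Finite := by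
  refine (Set.finite_Iic (Finsupp.onFinset s (fun β => if β ∈ s then n else 0) (by
    intro a; split_ifs <;> simp_all) : ForestMI)).subset fun F hF β => ?_
  by_cases h0 : F β = 0
  · simp [h0]
  · simp [h F hF β h0]

theorem ForestMI.le_norm (F : ForestMI) (β : PopMI) :
    F β * miNorm β.1 ≤ F.norm := by
  by_cases h0 : F β = 0
  · simp [h0]
  · exact Finset.single_le_sum (f := fun β : PopMI => F β * miNorm β.1)
      (fun _ _ => Nat.zero_le _) (Finsupp.mem_support_iff.2 h0)

theorem le_norm (β : ℕ →₀ ℕ) (k : ℕ) : β k ≤ miNorm β := by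
  by_cases h0 : β k = 0
  · simp [h0]
  · exact Finset.single_le_sum (f := fun k => β k) (fun _ _ => Nat.zero_le _)
      (Finsupp.mem_support_iff.2 h0)

theorem PopMI.lt_norm (β : PopMI) (k : ℕ) (hk : β.1 k ≠ 0) : k < miNorm β.1 := by
  have h := β.2
  have hk' := Finset.single_le_sum (f := fun k => k * β.1 k) (fun _ _ => Nat.zero_le _)
        (Finsupp.mem_support_iff.2 hk)
  have h2 : ((∑ k ∈ β.1.support, β.1 k : ℕ) : ℤ) - (∑ k ∈ β.1.support, k * β.1 k : ℕ) = 1 := by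
    rw [← h]
    simp only [Finsupp.sum]
    push_cast
    rw [← Finset.sum_sub_distrib]
    exact Finset.sum_congr rfl fun _ _ => by ring
  have h3 : k ≤ k * β.1 k := Nat.le_mul_of_pos_right _ (Nat.pos_of_ne_zero hk)
  simp only [miNorm, Finsupp.sum]
  omega

theorem finite_norm_le (n : ℕ) : {β : PopMI | miNorm β.1 ≤ n}.Finite := by
  have h : {β : ℕ →₀ ℕ | ∀ k, β k ≤ n ∧ (β k ≠ 0 → k < n)}.Finite := by
    refine (Set.finite_Iic (Finsupp.onFinset (Finset.range n)
      (fun k => if k < n then n else 0) (by intro a; simp; tauto) : ℕ →₀ ℕ)).subset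
      fun β hβ k => ?_
    by_cases h0 : β k = 0
    · simp [h0]
    · simp [(hβ k).2 h0, (hβ k).1]
  refine (h.preimage (Subtype.val_injective.injOn)).subset fun β hβ k => ?_
  exact ⟨(le_norm _ _).trans hβ, fun hk => (PopMI.lt_norm β k hk).trans_le hβ⟩

theorem finite_forests_norm (n : ℕ) : {F : ForestMI | F.norm = n}.Finite := by
  refine ForestMI.finite_of_le (finite_norm_le n).toFinset n _ fun F hF β hβ => ?_
  have h1 := ForestMI.le_norm F β
  have h2 := PopMI.norm_pos β
  have h3 := Nat.pos_of_ne_zero hβ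
  rw [Set.mem_ofPred_eq] at hF
  rw [Set.Finite.mem_toFinset, Set.mem_ofPred_eq]
  constructor <;> nlinarith

theorem norm_mono {α β : ℕ →₀ ℕ} (h : α ≤ β) : miNorm α ≤ miNorm β := by
  obtain ⟨γ, rfl⟩ := exists_add_of_le h
  unfold miNorm
  rw [Finsupp.sum_add_index' (by simp) (by simp)]
  omega

theorem ForestMI.norm_total (F : ForestMI) : miNorm F.total = F.norm := by
  let g : (ℕ →₀ ℕ) →+ ℕ := Finsupp.liftAddHom fun _ => AddMonoidHom.id ℕ
  have hg : ∀ α, miNorm α = g α := fun _ => rfl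
  simp only [ForestMI.total, ForestMI.norm, hg, map_finsuppSum, map_nsmul, smul_eq_mul]

theorem finite_partitions (β : ℕ →₀ ℕ) : {F : ForestMI | F ≠ 0 ∧ F.total ≤ β}.Finite := by
  refine ((Set.finite_le_nat (miNorm β)).biUnion fun n _ => finite_forests_norm n).subset ?_
  rintro F ⟨-, hF⟩
  simp only [Set.mem_iUnion, Set.mem_ofPred_eq]
  exact ⟨_, by simpa [ForestMI.norm_total] using norm_mono hF, rfl⟩

/-- The non-empty unordered collections `β₁, …, βₙ` of populated multi-indices for which
`β = β₁ + ⋯ + βₙ + β̂` for some multi-index `β̂`. -/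
def partitions (β : ℕ →₀ ℕ) : Finset ForestMI := (finite_partitions β).toFinset

/-- The coproduct of the Hopf algebra of multi-indices, given on populated multi-indices and
multiplicative for the forest product. -/
def coproductM : HM →ₐ[ℝ] HM ⊗[ℝ] HM :=
  MvPolynomial.aeval fun β : PopMI =>
    1 ⊗ₜ MvPolynomial.X β + MvPolynomial.X β ⊗ₜ 1 +
      ∑ F ∈ partitions β.1, ((F.symExt : ℝ)⁻¹) •
        (MvPolynomial.monomial F (1 : ℝ) ⊗ₜ[ℝ]
          toHM ((Dbar ^ F.card) (MvPolynomial.monomial (β.1 - F.total) (1 : ℝ))))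

/-- The pairing `⟨F, G⟩ = S(F) δ_{F,G}` on forests of multi-indices. -/
def pairM : HM →ₗ[ℝ] HM →ₗ[ℝ] ℝ :=
  (MvPolynomial.basisMonomials PopMI ℝ).constr ℝ fun F : ForestMI => (ForestMI.sym F : ℝ) • MvPolynomial.lcoeff ℝ F

/-- The induced pairing on `HM ⊗ HM`: `⟨u ⊗ v, h ⊗ k⟩ = ⟨u, h⟩ ⟨v, k⟩`. -/
def pairM₂ : HM ⊗[ℝ] HM →ₗ[ℝ] HM ⊗[ℝ] HM →ₗ[ℝ] ℝ :=
  TensorProduct.lift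
    (LinearMap.mk₂ ℝ (fun u v => LinearMap.mul' ℝ ℝ ∘ₗ TensorProduct.map (pairM u) (pairM v))
      (fun _ _ _ => by simp [TensorProduct.map_add_left, LinearMap.comp_add])
      (fun _ _ _ => by simp [TensorProduct.map_smul_left, LinearMap.comp_smul])
      (fun _ _ _ => by simp [TensorProduct.map_add_right, LinearMap.comp_add])
      (fun _ _ _ => by simp [TensorProduct.map_smul_right, LinearMap.comp_smul]))

/-- The graded dual of the coproduct, a product on the graded dual, which is identified with `HM`
through the pairing: for forests `F` and `G`, the component of `F ⋆ G` of norm `|F| + |G|` pairs with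
`h` to `⟨F ⊗ G, Δ h⟩`, and its other components vanish. -/
def starM : HM →ₗ[ℝ] HM →ₗ[ℝ] HM :=
  (MvPolynomial.basisMonomials PopMI ℝ).constr ℝ fun F =>
    (MvPolynomial.basisMonomials PopMI ℝ).constr ℝ fun G =>
      ∑ K ∈ (finite_forests_norm (ForestMI.norm F + ForestMI.norm G)).toFinset,
        MvPolynomial.monomial K
          (pairM₂ (MvPolynomial.monomial F 1 ⊗ₜ MvPolynomial.monomial G 1)
            (coproductM (MvPolynomial.monomial K 1)) / (ForestMI.sym K : ℝ))

/-! ### The map from trees to multi-indices -/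

/-- The number of branches at the root. -/
def PlanarTree.rootDeg : PlanarTree → ℕ
  | .bullet => 0
  | .adjoin _ t => t.rootDeg + 1

/-- The multi-index of all vertices other than the root: `β(k)` of them have `k` branches. -/
def PlanarTree.phiBelow : PlanarTree → (ℕ →₀ ℕ)
  | .bullet => 0
  | .adjoin a t => (Finsupp.single a.rootDeg 1 + a.phiBelow) + t.phiBelow

/-- The multi-index of a planar tree: `β(k)` vertices have `k` branches. -/
def PlanarTree.phi (t : PlanarTree) : ℕ →₀ ℕ := Finsupp.single t.rootDeg 1 + t.phiBelow

theorem PlanarTree.Step.rootDeg_eq {t t' : PlanarTree} (h : Step t t') :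
    t.rootDeg = t'.rootDeg := by
  induction h <;> simp_all [PlanarTree.rootDeg]

theorem PlanarTree.Step.phiBelow_eq {t t' : PlanarTree} (h : Step t t') :
    t.phiBelow = t'.phiBelow := by
  induction h with
  | swap a b t => simp only [PlanarTree.phiBelow]; abel
  | left t h ih => simp only [PlanarTree.phiBelow, ih, h.rootDeg_eq]
  | right a h ih => simp only [PlanarTree.phiBelow, ih]

theorem PlanarTree.populated_phi (t : PlanarTree) : Populated t.phi := by
  have hadd : ∀ α β : ℕ →₀ ℕ, (α + β).sum (fun k b => (1 - (k : ℤ)) * (b : ℤ)) =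
      α.sum (fun k b => (1 - (k : ℤ)) * (b : ℤ)) + β.sum (fun k b => (1 - (k : ℤ)) * (b : ℤ)) :=
    fun α β => Finsupp.sum_add_index' (by simp) (by intros; push_cast; ring)
  have hsingle : ∀ k : ℕ, (Finsupp.single k 1).sum (fun k b => (1 - (k : ℤ)) * ((b : ℕ) : ℤ)) =
      1 - (k : ℤ) := fun k => by rw [Finsupp.sum_single_index] <;> simp
  have hbelow : ∀ t : PlanarTree,
      t.phiBelow.sum (fun k b => (1 - (k : ℤ)) * (b : ℤ)) = t.rootDeg := by
    intro t
    induction t with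
    | bullet => simp [PlanarTree.phiBelow, PlanarTree.rootDeg]
    | adjoin a t iha iht =>
      simp only [PlanarTree.phiBelow, PlanarTree.rootDeg, hadd, hsingle, iha, iht]
      push_cast
      ring
  simp only [Populated, PlanarTree.phi, hadd, hsingle, hbelow]
  ring

/-- The map `Φ` from rooted trees to populated multi-indices. -/
def RTree.phi (t : RTree) : PopMI :=
  Quot.lift (fun t : PlanarTree => (⟨t.phi, t.populated_phi⟩ : PopMI))
    (fun _ _ h => Subtype.ext (by simp only [PlanarTree.phi, h.rootDeg_eq, h.phiBelow_eq])) t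

/-- The map `Φ` extended to forests, `Φ(τ₁ ⊙ ⋯ ⊙ τₙ)` being the forest of the multi-indices `Φ(τᵢ)`,
and to their linear combinations. -/
def Phi : HBCK →ₐ[ℝ] HM := MvPolynomial.rename RTree.phi

/-! ### Elementary differentials -/

/-- The product over all vertices other than the root of `f^(k)(y)`, with `k` the number of branches
at the vertex. -/
def PlanarTree.elemBelow (f : ℝ → ℝ) (y : ℝ) : PlanarTree → ℝ
  | .bullet => 1
  | .adjoin a t => (iteratedDeriv a.rootDeg f y * a.elemBelow f y) * t.elemBelow f y

theorem PlanarTree.Step.elemBelow_eq (f : ℝ → ℝ) (y : ℝ) {t t' : PlanarTree} (h : Step t t') :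
    t.elemBelow f y = t'.elemBelow f y := by
  induction h with
  | swap a b t => simp only [PlanarTree.elemBelow]; ring
  | left t h ih => simp only [PlanarTree.elemBelow, ih, h.rootDeg_eq]
  | right a h ih => simp only [PlanarTree.elemBelow, ih]

/-- The elementary differential `Υ_f[τ]` of a rooted tree for a scalar function `f`;
see `elemTree_bullet` and `elemTree_bplus` for its recursive description. -/
def elemTree (f : ℝ → ℝ) (t : RTree) (y : ℝ) : ℝ :=
  Quot.lift (fun t : PlanarTree => iteratedDeriv t.rootDeg f y * t.elemBelow f y)
    (fun _ _ h => by simp only [h.rootDeg_eq, h.elemBelow_eq]) t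

/-- `Φ(B₊(τ₁, …, τₙ)) = z_n ∏ᵢ Φ(τᵢ)`. -/
theorem RTree.phi_bplus (s : Multiset RTree) :
    (RTree.phi (RTree.bplus s)).1 = Finsupp.single s.card 1 + (s.map fun t => (RTree.phi t).1).sum := by
  have key : ∀ s : Multiset RTree, ∃ t : PlanarTree, RTree.bplus s = Quot.mk _ t ∧
      t.rootDeg = s.card ∧ t.phiBelow = (s.map fun t => (RTree.phi t).1).sum := by
    intro s
    induction s using Multiset.induction with
    | empty => exact ⟨.bullet, rfl, rfl, rfl⟩
    | cons a s ih =>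
      obtain ⟨t, h1, h2, h3⟩ := ih
      obtain ⟨a, rfl⟩ : ∃ b : PlanarTree, RTree.mk b = a := Quot.exists_rep a
      refine ⟨.adjoin a t, ?_, ?_, ?_⟩
      · rw [RTree.bplus, Multiset.foldr_cons, ← RTree.bplus, h1]; rfl
      · simp [PlanarTree.rootDeg, h2]
      · rw [Multiset.map_cons, Multiset.sum_cons, ← h3]; rfl
  obtain ⟨t, h1, h2, h3⟩ := key s
  rw [h1, ← h2, ← h3]
  rfl

theorem elemTree_bullet (f : ℝ → ℝ) : elemTree f RTree.bullet = f := by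
  funext y
  simp [elemTree, RTree.bullet, PlanarTree.rootDeg, PlanarTree.elemBelow]

/-- `Υ_f[B₊(τ₁, …, τₙ)] = f^(n) ∏ᵢ Υ_f[τᵢ]`. -/
theorem elemTree_bplus (f : ℝ → ℝ) (s : Multiset RTree) (y : ℝ) :
    elemTree f (RTree.bplus s) y =
      iteratedDeriv s.card f y * (s.map fun t => elemTree f t y).prod := by
  have key : ∀ s : Multiset RTree, ∃ t : PlanarTree, RTree.bplus s = Quot.mk _ t ∧
      t.rootDeg = s.card ∧ t.elemBelow f y = (s.map fun t => elemTree f t y).prod := by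
    intro s
    induction s using Multiset.induction with
    | empty => exact ⟨.bullet, rfl, rfl, rfl⟩
    | cons a s ih =>
      obtain ⟨t, h1, h2, h3⟩ := ih
      obtain ⟨a, rfl⟩ : ∃ b : PlanarTree, RTree.mk b = a := Quot.exists_rep a
      refine ⟨.adjoin a t, ?_, ?_, ?_⟩
      · rw [RTree.bplus, Multiset.foldr_cons, ← RTree.bplus, h1]; rfl
      · simp [PlanarTree.rootDeg, h2]
      · rw [Multiset.map_cons, Multiset.prod_cons, ← h3]; rfl
  obtain ⟨t, h1, h2, h3⟩ := key s
  rw [h1, ← h2, ← h3]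
  rfl

/-- The elementary differential `Ῡ_f[z^β] = ∏ₖ (f^(k))^β(k)` of a multi-index. -/
def elemMI (f : ℝ → ℝ) (β : PopMI) (y : ℝ) : ℝ :=
  β.1.prod fun k b => iteratedDeriv k f y ^ b

/-- The elementary vector field `Ῡ_f[u]{φ}`, linear in `u`, which on a forest is
`Ῡ_f[z^β₁ ⋯ z^βₙ]{φ} = (∏ᵢ Ῡ_f[z^βᵢ]) φ^(n)`. -/
def elemField (f φ : ℝ → ℝ) : HM →ₗ[ℝ] (ℝ → ℝ) :=
  (MvPolynomial.basisMonomials PopMI ℝ).constr ℝ fun F y =>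
    (F.prod fun β r => elemMI f β y ^ r) * iteratedDeriv (ForestMI.card F) φ y

/-- `Ῡ_f[u ⊗ v]{φ ⊗ ψ} = Ῡ_f[u]{φ} Ῡ_f[v]{ψ}`, extended linearly. -/
def elemField₂ (f φ ψ : ℝ → ℝ) : HM ⊗[ℝ] HM →ₗ[ℝ] (ℝ → ℝ) :=
  LinearMap.mul' ℝ (ℝ → ℝ) ∘ₗ TensorProduct.map (elemField f φ) (elemField f ψ)

end

end MultiIndexFlow

open MultiIndexFlow

namespace MultiIndexFlow

noncomputable section

open Classical

/-! ### Linear maps on polynomials and their convolution -/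

section Convolution

variable {σ : Type} {A B M : Type*} [CommRing A] [Algebra ℝ A] [CommRing B] [Algebra ℝ B]
  [AddCommGroup M] [Module ℝ M]

/-! The product `starM` is determined by a recursion in its right argument: `u ⋆ 1 = u`
(`starM_one`), and `u ⋆ (z^α v)` is the sum of `graftMI α u' * (u'' ⋆ v)` over the unshuffles `u' ⊗
u''` of `u` (`starM_X_mul`). Here `graftMI α` sends `z^β₁ ⋯ z^βₙ` to `z^(β₁ + ⋯ + βₙ) Dⁿ z^α`, with
`D = ∑ₖ z_{k+1} ∂_{z_k}`. Compatibility with trees and with differential operators both consist in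
recognising this recursion elsewhere.

The recursion comes from duality. Multiplication by `z^α` is adjoint, up to `S(z^α)`, to `∂_α`. The
right legs of the coproduct of a generator have degree at most one, so `∂_α` turns them into
scalars, and the Leibniz rule propagates this to forests. The resulting left legs are identified
because `Dbar` is the adjoint of `D` for the weights `S(z^β)` (`pairMI_raise`). As `starM` is
defined by its component of norm `|F| + |G|` only, full duality also needs the coproduct to be
homogeneous, which follows from its commuting with a scaling.

For functions, `z_k ↦ f^(k)` turns `D` into `d/dy`, so `graftMI α u` evaluates to
`Ῡ_f[u]{Ῡ_f[z^α]}`. The Leibniz rule `conv_elemField` then gives composition the same recursion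
(`elemField_starM`).

For trees, joining a branch to a vertex with `d` branches turns its factor `z_d` into `z_{d+1}`.
Summing over the vertices is the Leibniz rule for `D`, so `Φ` carries grafting onto `τ` to `graftMI`
at `Φ(τ)` (`Phi_distSum_attach`). Distributing branches over the vertices of several trees is an
iterated unshuffle (`distSum_sum`), which again produces the recursion
(`Phi_conv_distSum_forestAttach`). -/

theorem linearMap_ext_monomial {f g : MvPolynomial σ ℝ →ₗ[ℝ] M}
    (h : ∀ s, f (MvPolynomial.monomial s 1) = g (MvPolynomial.monomial s 1)) : f = g :=
  (MvPolynomial.basisMonomials σ ℝ).ext fun s => by simpa using h s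

theorem constr_monomial (f : (σ →₀ ℕ) → M) (s : σ →₀ ℕ) :
    (MvPolynomial.basisMonomials σ ℝ).constr ℝ f (MvPolynomial.monomial s 1) = f s := by
  have := (MvPolynomial.basisMonomials σ ℝ).constr_basis ℝ f s
  rwa [MvPolynomial.coe_basisMonomials] at this

theorem X_mul_monomial (a : σ) (s : σ →₀ ℕ) :
    MvPolynomial.X a * MvPolynomial.monomial s (1 : ℝ) =
      MvPolynomial.monomial (Finsupp.single a 1 + s) 1 := by
  rw [MvPolynomial.X, MvPolynomial.monomial_mul, one_mul]

/-- Induction on the length of a forest. Most uses generalize over the linear maps or test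
functions, since removing a variable changes them. -/
theorem polynomial_induction {motive : MvPolynomial σ ℝ → Prop} (u : MvPolynomial σ ℝ)
    (one : motive 1) (smul : ∀ (c : ℝ) u, motive u → motive (c • u))
    (add : ∀ u v, motive u → motive v → motive (u + v))
    (X_mul : ∀ a u, motive u → motive (MvPolynomial.X a * u)) : motive u := by
  induction u using MvPolynomial.induction_on with
  | C a => simpa [MvPolynomial.smul_eq_C_mul] using smul a 1 one
  | add p q hp hq => exact add p q hp hq
  | mul_X p n hp => rw [mul_comm]; exact X_mul n p hp

/-! ### Convolution for the unshuffle coproduct -/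

/-- Multiplication by a variable. -/
def mulX (a : σ) : MvPolynomial σ ℝ →ₗ[ℝ] MvPolynomial σ ℝ :=
  LinearMap.mulLeft ℝ (MvPolynomial.X a)

@[simp]
theorem mulX_apply (a : σ) (u : MvPolynomial σ ℝ) : mulX a u = MvPolynomial.X a * u := rfl

/-- The convolution product of linear maps with respect to the unshuffle coproduct. -/
def conv (p q : MvPolynomial σ ℝ →ₗ[ℝ] A) : MvPolynomial σ ℝ →ₗ[ℝ] A :=
  LinearMap.mul' ℝ A ∘ₗ TensorProduct.map p q ∘ₗ (unshuffle σ).toLinearMap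

theorem conv_apply (p q : MvPolynomial σ ℝ →ₗ[ℝ] A) (u : MvPolynomial σ ℝ) :
    conv p q u = LinearMap.mul' ℝ A (TensorProduct.map p q (unshuffle σ u)) := rfl

theorem unshuffle_X_mul (a : σ) (u : MvPolynomial σ ℝ) :
    unshuffle σ (MvPolynomial.X a * u) =
      (MvPolynomial.X a ⊗ₜ 1 + 1 ⊗ₜ MvPolynomial.X a) * unshuffle σ u := by
  rw [map_mul]
  simp [unshuffle]

@[simp]
theorem conv_one (p q : MvPolynomial σ ℝ →ₗ[ℝ] A) : conv p q 1 = p 1 * q 1 := by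
  rw [conv_apply, map_one, Algebra.TensorProduct.one_def]
  simp

/-- Variables are primitive, so precomposition with `mulX a` obeys a Leibniz rule for convolution.
Commutativity, left commutativity and the unit law follow from this rule by induction, without
coassociativity. -/
theorem conv_X_mul (p q : MvPolynomial σ ℝ →ₗ[ℝ] A) (a : σ) (u : MvPolynomial σ ℝ) :
    conv p q (MvPolynomial.X a * u) = conv (p ∘ₗ mulX a) q u + conv p (q ∘ₗ mulX a) u := by
  simp only [conv_apply, unshuffle_X_mul, ← map_add]
  generalize unshuffle σ u = x
  induction x using TensorProduct.induction_on with
  | zero => simp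
  | tmul b c => simp [add_mul]
  | add x y hx hy => simp only [mul_add, map_add, hx, hy]; abel

theorem conv_add_left (p p' q : MvPolynomial σ ℝ →ₗ[ℝ] A) :
    conv (p + p') q = conv p q + conv p' q := by
  refine LinearMap.ext fun u => ?_
  simp [conv_apply, TensorProduct.map_add_left]

theorem conv_sum_left {ι : Type*} (s : Finset ι) (p : ι → MvPolynomial σ ℝ →ₗ[ℝ] A)
    (q : MvPolynomial σ ℝ →ₗ[ℝ] A) : conv (∑ i ∈ s, p i) q = ∑ i ∈ s, conv (p i) q := by
  induction s using Finset.induction_on with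
  | empty => exact LinearMap.ext fun u => by simp [conv_apply]
  | insert i s hi ih => simp [Finset.sum_insert hi, conv_add_left, ih]

theorem conv_comm (p q : MvPolynomial σ ℝ →ₗ[ℝ] A) : conv p q = conv q p := by
  refine LinearMap.ext fun u => ?_
  induction u using polynomial_induction generalizing p q with
  | one => simp [mul_comm]
  | smul c u ih => simp [ih p q]
  | add u v hu hv => simp [hu p q, hv p q]
  | X_mul a u ih => rw [conv_X_mul, conv_X_mul, ih, ih p, add_comm]

theorem conv_sum_right {ι : Type*} (s : Finset ι) (p : MvPolynomial σ ℝ →ₗ[ℝ] A)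
    (q : ι → MvPolynomial σ ℝ →ₗ[ℝ] A) : conv p (∑ i ∈ s, q i) = ∑ i ∈ s, conv p (q i) := by
  rw [conv_comm, conv_sum_left]
  exact Finset.sum_congr rfl fun i _ => conv_comm _ _

theorem conv_comp_mulX (p q : MvPolynomial σ ℝ →ₗ[ℝ] A) (a : σ) :
    conv p q ∘ₗ mulX a = conv (p ∘ₗ mulX a) q + conv p (q ∘ₗ mulX a) :=
  LinearMap.ext fun u => conv_X_mul p q a u

theorem conv_left_comm (p q r : MvPolynomial σ ℝ →ₗ[ℝ] A) :
    conv p (conv q r) = conv q (conv p r) := by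
  have add_right : ∀ p q q' : MvPolynomial σ ℝ →ₗ[ℝ] A,
      conv p (q + q') = conv p q + conv p q' := fun p q q' => by
    rw [conv_comm, conv_add_left, conv_comm q, conv_comm q']
  refine LinearMap.ext fun u => ?_
  induction u using polynomial_induction generalizing p q r with
  | one => simp [mul_left_comm]
  | smul c u ih => simp [ih p q r]
  | add u v hu hv => simp [hu p q r, hv p q r]
  | X_mul a u ih =>
    simp only [conv_X_mul, conv_comp_mulX, add_right, LinearMap.add_apply]
    rw [ih (p ∘ₗ mulX a), ih p (q ∘ₗ mulX a), ih p q (r ∘ₗ mulX a)]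
    abel

theorem algHom_comp_conv (g : A →ₐ[ℝ] B) (p q : MvPolynomial σ ℝ →ₗ[ℝ] A) :
    g.toLinearMap ∘ₗ conv p q = conv (g.toLinearMap ∘ₗ p) (g.toLinearMap ∘ₗ q) := by
  refine LinearMap.ext fun u => ?_
  simp only [LinearMap.comp_apply, conv_apply]
  generalize unshuffle σ u = x
  induction x using TensorProduct.induction_on with
  | zero => simp
  | tmul b c => simp
  | add x y hx hy => simp only [map_add, hx, hy]

/-- The counit, seen as a linear map with values in an algebra. -/
def counit (σ : Type) (A : Type*) [CommRing A] [Algebra ℝ A] : MvPolynomial σ ℝ →ₗ[ℝ] A :=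
  (MvPolynomial.aeval fun _ => 0 : MvPolynomial σ ℝ →ₐ[ℝ] A).toLinearMap

theorem counit_one : counit σ A 1 = 1 := by simp [counit]

theorem counit_X_mul (a : σ) (u : MvPolynomial σ ℝ) :
    counit σ A (MvPolynomial.X a * u) = 0 := by simp [counit]

theorem counit_comp_mulX (a : σ) : counit σ A ∘ₗ mulX a = 0 :=
  LinearMap.ext fun u => counit_X_mul a u

theorem conv_counit (p : MvPolynomial σ ℝ →ₗ[ℝ] A) : conv p (counit σ A) = p := by
  have conv_zero : ∀ p : MvPolynomial σ ℝ →ₗ[ℝ] A, conv p 0 = 0 := fun p => by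
    simpa using conv_sum_right (ι := ℕ) ∅ p 0
  refine LinearMap.ext fun u => ?_
  induction u using polynomial_induction generalizing p with
  | one => simp [counit_one]
  | smul c u ih => simp [ih p]
  | add u v hu hv => simp [hu p, hv p]
  | X_mul a u ih => rw [conv_X_mul, ih, counit_comp_mulX, conv_zero]; simp

/-- Renaming the variables is compatible with the unshuffle coproducts. -/
theorem unshuffle_rename {τ : Type} (e : σ → τ) (u : MvPolynomial σ ℝ) :
    unshuffle τ (MvPolynomial.rename e u) =
      TensorProduct.map (MvPolynomial.rename e).toLinearMap (MvPolynomial.rename e).toLinearMap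
        (unshuffle σ u) := by
  have h : (unshuffle τ).comp (MvPolynomial.rename e) =
      (Algebra.TensorProduct.map (MvPolynomial.rename e) (MvPolynomial.rename e)).comp
        (unshuffle σ) :=
    MvPolynomial.algHom_ext fun i => by simp [unshuffle]
  exact DFunLike.congr_fun h u

theorem conv_comp_rename {τ : Type} (e : σ → τ) (p q : MvPolynomial τ ℝ →ₗ[ℝ] A) :
    conv p q ∘ₗ (MvPolynomial.rename e).toLinearMap =
      conv (p ∘ₗ (MvPolynomial.rename e).toLinearMap)
        (q ∘ₗ (MvPolynomial.rename e).toLinearMap) := by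
  refine LinearMap.ext fun u => ?_
  simp only [LinearMap.comp_apply, conv_apply, AlgHom.toLinearMap_apply, unshuffle_rename]
  rw [← LinearMap.comp_apply (TensorProduct.map p q), ← TensorProduct.map_comp]

theorem conv_mulLeft_left (c : A) (p q : MvPolynomial σ ℝ →ₗ[ℝ] A) :
    conv (LinearMap.mulLeft ℝ c ∘ₗ p) q = LinearMap.mulLeft ℝ c ∘ₗ conv p q := by
  refine LinearMap.ext fun u => ?_
  simp only [LinearMap.comp_apply, conv_apply]
  generalize unshuffle σ u = x
  induction x using TensorProduct.induction_on with
  | zero => simp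
  | tmul a b => simp [mul_assoc]
  | add x y hx hy => simp only [map_add, hx, hy]

theorem conv_mulLeft_right (c : A) (p q : MvPolynomial σ ℝ →ₗ[ℝ] A) :
    conv p (LinearMap.mulLeft ℝ c ∘ₗ q) = LinearMap.mulLeft ℝ c ∘ₗ conv p q := by
  rw [conv_comm, conv_mulLeft_left, conv_comm q]

/-! ### Extension from the variables, and orthogonal pairings of monomials -/

/-- The linear map which is `w` on the variables and vanishes on all the other monomials. -/
def primitiveExt (w : σ → M) : MvPolynomial σ ℝ →ₗ[ℝ] M :=
  (MvPolynomial.basisMonomials σ ℝ).constr ℝ fun s =>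
    if (s.sum fun _ r => r) = 1 then ∑ a ∈ s.support, w a else 0

theorem primitiveExt_one (w : σ → M) : primitiveExt w 1 = 0 := by
  rw [← MvPolynomial.C_1, MvPolynomial.C_apply, primitiveExt, constr_monomial]
  simp

/-- Only the constant term of `u` contributes to the degree one part of `X a * u`. -/
theorem primitiveExt_X_mul (w : σ → M) (a : σ) (u : MvPolynomial σ ℝ) :
    primitiveExt w (MvPolynomial.X a * u) = MvPolynomial.constantCoeff u • w a := by
  have : primitiveExt w ∘ₗ mulX a = (MvPolynomial.lcoeff ℝ 0).smulRight (w a) :=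
    linearMap_ext_monomial fun s => by
      rw [LinearMap.comp_apply, mulX_apply, X_mul_monomial, primitiveExt, constr_monomial,
        Finsupp.sum_add_index' (by simp) (by simp), Finsupp.sum_single_index rfl]
      rcases eq_or_ne s 0 with rfl | hs
      · simp
      · obtain ⟨b, hb⟩ := Finsupp.ne_iff.1 hs
        have := Finset.single_le_sum (f := fun b => s b) (fun _ _ => Nat.zero_le _)
          (Finsupp.mem_support_iff.2 hb)
        rw [if_neg (by simp only [Finsupp.sum] at *; simp at hb; omega)]
        simp [MvPolynomial.coeff_monomial, hs]
  exact DFunLike.congr_fun this u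

/-- The pairing for which the monomials are orthogonal, with given squared norms. -/
def weightedPair (w : (σ →₀ ℕ) → ℝ) : MvPolynomial σ ℝ →ₗ[ℝ] MvPolynomial σ ℝ →ₗ[ℝ] ℝ :=
  (MvPolynomial.basisMonomials σ ℝ).constr ℝ fun F => w F • MvPolynomial.lcoeff ℝ F

theorem weightedPair_monomial (w : (σ →₀ ℕ) → ℝ) (F : σ →₀ ℕ) (h : MvPolynomial σ ℝ) :
    weightedPair w (MvPolynomial.monomial F 1) h = w F * MvPolynomial.coeff F h := by
  rw [weightedPair, constr_monomial]
  simp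

theorem weightedPair_symm (w : (σ →₀ ℕ) → ℝ) (u h : MvPolynomial σ ℝ) :
    weightedPair w u h = weightedPair w h u := by
  have : weightedPair w = (weightedPair w).flip :=
    linearMap_ext_monomial fun F => linearMap_ext_monomial fun G => by
      rw [LinearMap.flip_apply, weightedPair_monomial, weightedPair_monomial,
        MvPolynomial.coeff_monomial, MvPolynomial.coeff_monomial]
      by_cases h : F = G
      · simp [h]
      · simp [h, Ne.symm h]
  exact DFunLike.congr_fun (DFunLike.congr_fun this u) h

end Convolution

/-! ### The pairing on forests -/

theorem symMI_add (α β : ℕ →₀ ℕ) : symMI (α + β) = symMI α * symMI β :=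
  Finsupp.prod_add_index' (by simp) (by intros; rw [pow_add])

theorem symMI_pos (β : ℕ →₀ ℕ) : 0 < symMI β :=
  Finset.prod_pos fun k _ => pow_pos k.factorial_pos _

theorem ForestMI.sym_pos (F : ForestMI) : 0 < F.sym :=
  Finset.prod_pos fun β _ => mul_pos (F β).factorial_pos (pow_pos (symMI_pos _) _)

theorem ForestMI.symExt_pos (F : ForestMI) : 0 < F.symExt :=
  Finset.prod_pos fun β _ => (F β).factorial_pos

/-- The internal factors depend only on the total multi-index. The external factor is the one
cancelled by `1 / S_ext(F)` in the coproduct. -/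
theorem ForestMI.sym_eq (F : ForestMI) : F.sym = F.symExt * symMI F.total := by
  have h : symMI F.total = F.prod fun β r => symMI β.1 ^ r := by
    let g : Multiplicative (ℕ →₀ ℕ) →* ℕ :=
      { toFun := fun β => symMI β.toAdd
        map_one' := by simp [symMI]
        map_mul' := fun α β => symMI_add _ _ }
    have := map_finsuppProd g F fun β r => Multiplicative.ofAdd (r • β.1)
    simp only [ofAdd_nsmul, map_pow] at this
    exact this
  rw [h, ForestMI.sym, ForestMI.symExt, ← Finsupp.prod_mul]

/-- The factor `F β + 1` is the exponent brought down by differentiation; this makes multiplication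
and derivative adjoint. -/
theorem ForestMI.sym_single_add (β : PopMI) (F : ForestMI) :
    (Finsupp.single β 1 + F : ForestMI).sym = symMI β.1 * (F β + 1) * F.sym := by
  -- Both products are taken over one index set, as `β` need not lie in the support of `F`.
  have h : ∀ G : ForestMI, ∀ s : Finset PopMI, G.support ⊆ s →
      G.sym = ∏ γ ∈ s, (G γ).factorial * symMI γ.1 ^ G γ := fun G s hs =>
    Finsupp.prod_of_support_subset _ hs _ (by simp)
  have hβ : β ∈ insert β F.support := Finset.mem_insert_self _ _
  rw [h _ (insert β F.support), h F (insert β F.support) (Finset.subset_insert _ _),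
    ← Finset.mul_prod_erase _ _ hβ, ← Finset.mul_prod_erase _ _ hβ,
    Finset.prod_congr rfl (g := fun γ => (F γ).factorial * symMI γ.1 ^ F γ)]
  · simp only [Finsupp.add_apply, Finsupp.single_eq_same, add_comm 1, Nat.factorial_succ, pow_succ]
    ring
  · intro γ hγ
    simp [Finsupp.single_eq_of_ne (Finset.ne_of_mem_erase hγ)]
  · refine Finsupp.support_add.trans ?_
    rw [Finset.insert_eq]
    exact Finset.union_subset_union Finsupp.support_single_subset subset_rfl

theorem pairM_monomial (F : ForestMI) (h : HM) :
    pairM (MvPolynomial.monomial F 1) h = F.sym * MvPolynomial.coeff F h :=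
  weightedPair_monomial (fun F : ForestMI => (F.sym : ℝ)) F h

theorem pairM_symm (u h : HM) : pairM u h = pairM h u :=
  weightedPair_symm (fun F : ForestMI => (F.sym : ℝ)) u h

theorem eq_of_pairM_eq {u v : HM} (h : ∀ k, pairM u k = pairM v k) : u = v := by
  ext F
  have := h (MvPolynomial.monomial F 1)
  rw [pairM_symm, pairM_symm v, pairM_monomial, pairM_monomial] at this
  exact mul_left_cancel₀ (Nat.cast_ne_zero.2 (ForestMI.sym_pos F).ne') this

theorem pairM_one (h : HM) : pairM 1 h = MvPolynomial.constantCoeff h := by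
  have := pairM_monomial 0 h
  simpa [ForestMI.sym, MvPolynomial.constantCoeff_eq] using this

/-- Up to the symmetry factor, the multiplication by `z^β` is dual to the derivative. -/
theorem pairM_X_mul (β : PopMI) (u h : HM) :
    pairM (MvPolynomial.X β * u) h = symMI β.1 * pairM u (MvPolynomial.pderiv β h) := by
  have : pairM ∘ₗ mulX β = (symMI β.1 : ℝ) •
      (pairM.compl₂ (MvPolynomial.pderiv β).toLinearMap) :=
    linearMap_ext_monomial fun F => linearMap_ext_monomial fun G => by
      simp only [LinearMap.comp_apply, mulX_apply, X_mul_monomial, pairM_monomial,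
        LinearMap.smul_apply, LinearMap.compl₂_apply, Derivation.coeFn_coe, smul_eq_mul,
        MvPolynomial.pderiv_monomial, one_mul, MvPolynomial.coeff_monomial,
        ForestMI.sym_single_add]
      by_cases h : G = Finsupp.single β 1 + F
      · subst h
        simp
        ring
      · rw [if_neg h]
        split_ifs with h'
        -- Subtraction is truncated: `G - single β 1 = F` without `G = single β 1 + F` forces `G β =
        -- 0`, and then the derivative vanishes.
        · have h0 : G β = 0 := by
            by_contra h0
            apply h
            rw [← h', add_tsub_cancel_of_le]
            simpa using Nat.one_le_iff_ne_zero.2 h0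
          simp [h0]
        · simp
  exact DFunLike.congr_fun (DFunLike.congr_fun this u) h

theorem pairM₂_tmul (u v h k : HM) : pairM₂ (u ⊗ₜ v) (h ⊗ₜ k) = pairM u h * pairM v k := by
  simp [pairM₂]

/-- The unshuffle coproduct is dual to the forest product. -/
theorem pairM₂_unshuffle (u h k : HM) :
    pairM₂ (unshuffle PopMI u) (h ⊗ₜ k) = pairM u (h * k) := by
  induction u using polynomial_induction generalizing h k with
  | one =>
    rw [map_one, Algebra.TensorProduct.one_def, pairM₂_tmul, pairM_one, pairM_one, pairM_one,
      map_mul]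
  | smul c u ih => simp [ih]
  | add u v hu hv => simp [hu, hv]
  | X_mul β u ih =>
    have hx : ∀ x : HM ⊗[ℝ] HM,
        pairM₂ ((MvPolynomial.X β ⊗ₜ 1 + 1 ⊗ₜ MvPolynomial.X β) * x) (h ⊗ₜ k) =
          symMI β.1 * (pairM₂ x (MvPolynomial.pderiv β h ⊗ₜ k) +
            pairM₂ x (h ⊗ₜ MvPolynomial.pderiv β k)) := by
      intro x
      induction x using TensorProduct.induction_on with
      | zero => simp
      | tmul b c =>
        simp only [add_mul, Algebra.TensorProduct.tmul_mul_tmul, one_mul, map_add,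
          LinearMap.add_apply, pairM₂_tmul, pairM_X_mul]
        ring
      | add x y hx hy => simp only [mul_add, map_add, LinearMap.add_apply, hx, hy]; ring
    rw [unshuffle_X_mul, hx, ih, ih, pairM_X_mul, Derivation.leibniz, smul_eq_mul, smul_eq_mul,
      map_add, add_comm, mul_comm k]

theorem pairM_mul (u v h : HM) : pairM (u * v) h = pairM₂ (u ⊗ₜ v) (unshuffle PopMI h) := by
  rw [pairM_symm, ← pairM₂_unshuffle]
  generalize unshuffle PopMI h = x
  induction x using TensorProduct.induction_on with
  | zero => simp
  | tmul b c => rw [pairM₂_tmul, pairM₂_tmul, pairM_symm b, pairM_symm c]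
  | add x y hx hy => simp only [map_add, LinearMap.add_apply, hx, hy]

/-! ### The derivation dual to `Dbar` -/

/-- The derivation `D = ∑ₖ z_{k+1} ∂_{z_k}`. -/
def raise : Derivation ℝ (MvPolynomial ℕ ℝ) (MvPolynomial ℕ ℝ) :=
  MvPolynomial.mkDerivation ℝ fun k => MvPolynomial.X (k + 1)

@[simp]
theorem raise_X (k : ℕ) : raise (MvPolynomial.X k) = MvPolynomial.X (k + 1) := by
  simp [raise]

theorem raise_monomial (α : ℕ →₀ ℕ) :
    raise (MvPolynomial.monomial α 1) = ∑ k ∈ α.support,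
      MvPolynomial.monomial (α - Finsupp.single k 1 + Finsupp.single (k + 1) 1) (α k : ℝ) := by
  rw [raise, MvPolynomial.mkDerivation_monomial, one_smul, Finsupp.sum]
  refine Finset.sum_congr rfl fun k _ => ?_
  rw [smul_eq_mul, MvPolynomial.X, MvPolynomial.monomial_mul, mul_one]

/-- The exponent brought down by `∂_{z_k}` cancels the denominator `γ k`. -/
theorem Dbar_monomial (γ : ℕ →₀ ℕ) :
    Dbar (MvPolynomial.monomial γ 1) = ∑ k ∈ γ.support.filter (0 < ·),
      MvPolynomial.monomial (Finsupp.single (k - 1) 1 + (γ - Finsupp.single k 1))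
        ((k : ℝ) * ((γ (k - 1) : ℝ) + 1)) := by
  rw [Dbar, constr_monomial]
  refine Finset.sum_congr rfl fun k hk => ?_
  have hk : (γ k : ℝ) ≠ 0 := by
    simp only [Finset.mem_filter, Finsupp.mem_support_iff] at hk
    exact_mod_cast hk.1
  rw [MvPolynomial.pderiv_monomial, MvPolynomial.X, MvPolynomial.monomial_mul,
    MvPolynomial.smul_monomial, one_mul, one_mul, smul_eq_mul, div_mul_cancel₀ _ hk]

theorem symMI_single (k : ℕ) : symMI (Finsupp.single k 1) = k.factorial := by
  simp [symMI]

/-- The pairing of polynomials in the `z_k` given by the symmetry factors. -/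
def pairMI : MvPolynomial ℕ ℝ →ₗ[ℝ] MvPolynomial ℕ ℝ →ₗ[ℝ] ℝ :=
  weightedPair fun β => (symMI β : ℝ)

/-- If `γ` arises from `α` by trading a `z_k` for a `z_{k+1}`, then `S(γ) = (k + 1) S(α)` and `α(k)
= γ(k) + 1`. These are the two factors in the coefficient of `Dbar`. -/
theorem pairMI_raise (p q : MvPolynomial ℕ ℝ) : pairMI (raise p) q = pairMI p (Dbar q) := by
  have : pairMI ∘ₗ raise.toLinearMap = pairMI.compl₂ Dbar :=
    linearMap_ext_monomial fun α => linearMap_ext_monomial fun γ => by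
      simp only [LinearMap.comp_apply, LinearMap.compl₂_apply, Derivation.coeFn_coe, pairMI]
      rw [weightedPair_symm, weightedPair_monomial, weightedPair_monomial, raise_monomial,
        Dbar_monomial, MvPolynomial.coeff_sum, MvPolynomial.coeff_sum, Finset.mul_sum,
        Finset.mul_sum]
      simp only [MvPolynomial.coeff_monomial]
      -- The index sets differ; only nonzero terms correspond, the `k`-th term of `D` to the `(k +
      -- 1)`-st of `Dbar`.
      refine Finset.sum_bij_ne_zero (fun k _ _ => k + 1) ?_ ?_ ?_ ?_
      · intro k hk h
        have hγ : α - Finsupp.single k 1 + Finsupp.single (k + 1) 1 = γ := by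
          by_contra h'
          simp [h'] at h
        simp [← hγ]
      · intro k _ _ l _ _ h
        simpa using h
      · intro l hl h
        have hα : Finsupp.single (l - 1) 1 + (γ - Finsupp.single l 1) = α := by
          by_contra h'
          simp [h'] at h
        simp only [Finset.mem_filter, Finsupp.mem_support_iff] at hl
        obtain ⟨k, rfl⟩ : ∃ k, l = k + 1 := ⟨l - 1, by omega⟩
        simp only [Nat.add_sub_cancel] at hα
        have hle : Finsupp.single (k + 1) 1 ≤ γ := by
          simpa using Nat.one_le_iff_ne_zero.2 hl.1
        refine ⟨k, by simp [← hα], ?_, rfl⟩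
        rw [if_pos, ← hα]
        · simp [(symMI_pos γ).ne']
          positivity
        · rw [← hα, add_tsub_cancel_left, tsub_add_cancel_of_le hle]
      · intro k hk h
        have hγ : α - Finsupp.single k 1 + Finsupp.single (k + 1) 1 = γ := by
          by_contra h'
          simp [h'] at h
        have hle : Finsupp.single k 1 ≤ α := by
          simpa using Nat.one_le_iff_ne_zero.2 (Finsupp.mem_support_iff.1 hk)
        obtain ⟨δ, rfl⟩ := exists_add_of_le hle
        rw [add_tsub_cancel_left] at hγ
        subst hγ
        simp only [add_tsub_cancel_left, add_tsub_cancel_right, if_true,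
          symMI_add, symMI_single, Nat.factorial_succ]
        simp
        ring
  exact DFunLike.congr_fun (DFunLike.congr_fun this p) q

theorem pairMI_raise_pow (n : ℕ) (p q : MvPolynomial ℕ ℝ) :
    pairMI ((raise.toLinearMap ^ n) p) q = pairMI p ((Dbar ^ n) q) := by
  induction n generalizing p with
  | zero => simp
  | succ n ih =>
    rw [pow_succ, pow_succ', Module.End.mul_apply, Module.End.mul_apply, ih,
      Derivation.coeFn_coe, pairMI_raise]

theorem symMI_mul_coeff_raise_pow (n : ℕ) (α γ : ℕ →₀ ℕ) :
    symMI γ * MvPolynomial.coeff γ ((raise.toLinearMap ^ n) (MvPolynomial.monomial α 1)) =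
      symMI α * MvPolynomial.coeff α ((Dbar ^ n) (MvPolynomial.monomial γ 1)) := by
  have := pairMI_raise_pow n (MvPolynomial.monomial α 1) (MvPolynomial.monomial γ 1)
  simpa only [pairMI, weightedPair_symm _ _ (MvPolynomial.monomial γ 1), weightedPair_monomial]
    using this

/-! ### Insertion of a forest into a multi-index -/

theorem ForestMI.card_single_add (β : PopMI) (F : ForestMI) :
    (Finsupp.single β 1 + F : ForestMI).card = F.card + 1 := by
  rw [ForestMI.card, Finsupp.sum_add_index' (by simp) (by simp), Finsupp.sum_single_index rfl,
    add_comm]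
  rfl

theorem ForestMI.total_single_add (β : PopMI) (F : ForestMI) :
    (Finsupp.single β 1 + F : ForestMI).total = β.1 + F.total := by
  rw [ForestMI.total, Finsupp.sum_add_index' (by simp) (by simp [add_smul]),
    Finsupp.sum_single_index (by simp), one_smul]
  rfl

/-- The insertion of forests into a polynomial `p` in the `z_k`, sending the forest
`z^β₁ ⋯ z^βₙ` to the polynomial `z^(β₁ + ⋯ + βₙ) Dⁿ p`. -/
def insertion (p : MvPolynomial ℕ ℝ) : HM →ₗ[ℝ] MvPolynomial ℕ ℝ :=
  (MvPolynomial.basisMonomials PopMI ℝ).constr ℝ fun F : ForestMI =>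
    MvPolynomial.monomial F.total 1 * (raise.toLinearMap ^ F.card) p

theorem insertion_monomial (p : MvPolynomial ℕ ℝ) (F : ForestMI) :
    insertion p (MvPolynomial.monomial F 1) =
      MvPolynomial.monomial F.total 1 * (raise.toLinearMap ^ F.card) p :=
  constr_monomial _ _

theorem insertion_one (p : MvPolynomial ℕ ℝ) : insertion p 1 = p := by
  have := insertion_monomial p 0
  simpa [ForestMI.total, ForestMI.card] using this

/-- One of the derivations is applied to `p` first, which turns the insertion of a longer forest
into an insertion into `raise p`. -/
theorem insertion_X_mul (p : MvPolynomial ℕ ℝ) (β : PopMI) (u : HM) :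
    insertion p (MvPolynomial.X β * u) =
      MvPolynomial.monomial β.1 1 * insertion (raise p) u := by
  have : insertion p ∘ₗ mulX β =
      LinearMap.mulLeft ℝ (MvPolynomial.monomial β.1 1) ∘ₗ insertion (raise p) :=
    linearMap_ext_monomial fun F => by
      rw [LinearMap.comp_apply, mulX_apply, X_mul_monomial, insertion_monomial,
        LinearMap.comp_apply, LinearMap.mulLeft_apply, insertion_monomial,
        ForestMI.card_single_add, ForestMI.total_single_add, pow_succ, Module.End.mul_apply,
        Derivation.coeFn_coe, ← mul_assoc, MvPolynomial.monomial_mul, one_mul]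
  exact DFunLike.congr_fun this u

theorem toHM_monomial (β : ℕ →₀ ℕ) : toHM (MvPolynomial.monomial β 1) =
    if h : Populated β then MvPolynomial.X (⟨β, h⟩ : PopMI) else 0 := constr_monomial _ _

/-- The image of `toHM` is spanned by single variables, so its derivatives are scalars. -/
theorem pderiv_toHM (α : PopMI) (p : MvPolynomial ℕ ℝ) :
    MvPolynomial.pderiv α (toHM p) = MvPolynomial.coeff α.1 p • 1 := by
  have : (MvPolynomial.pderiv α).toLinearMap ∘ₗ toHM =
      (MvPolynomial.lcoeff ℝ α.1).smulRight (1 : HM) := linearMap_ext_monomial fun β => by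
    rw [LinearMap.comp_apply, toHM_monomial, LinearMap.smulRight_apply, MvPolynomial.lcoeff_apply,
      MvPolynomial.coeff_monomial, Derivation.coeFn_coe]
    by_cases hβ : β = α.1
    · subst hβ
      simp [α.2]
    · rw [if_neg hβ]
      split_ifs with h
      · rw [MvPolynomial.pderiv_X_of_ne (fun h' => hβ (by rw [← h'])), zero_smul]
      · simp
  exact DFunLike.congr_fun this p

theorem constantCoeff_toHM (p : MvPolynomial ℕ ℝ) :
    MvPolynomial.constantCoeff (toHM p) = 0 := by
  have : MvPolynomial.lcoeff ℝ 0 ∘ₗ toHM = 0 := linearMap_ext_monomial fun β => by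
    rw [LinearMap.comp_apply, toHM_monomial, MvPolynomial.lcoeff_apply]
    split_ifs
    · rw [MvPolynomial.coeff_zero_X]; rfl
    · rfl
  exact DFunLike.congr_fun this p

/-! ### Duality between the coproduct and the product -/

theorem coproductM_X (γ : PopMI) : coproductM (MvPolynomial.X γ) =
    1 ⊗ₜ MvPolynomial.X γ + MvPolynomial.X γ ⊗ₜ 1 +
      ∑ F ∈ partitions γ.1, ((F.symExt : ℝ)⁻¹) •
        (MvPolynomial.monomial F (1 : ℝ) ⊗ₜ[ℝ]
          toHM ((Dbar ^ F.card) (MvPolynomial.monomial (γ.1 - F.total) (1 : ℝ)))) := by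
  rw [coproductM, MvPolynomial.aeval_X]

theorem mem_partitions {β : ℕ →₀ ℕ} {F : ForestMI} :
    F ∈ partitions β ↔ F ≠ 0 ∧ F.total ≤ β := by
  simp [partitions]

/-! ### Homogeneity of the coproduct -/

/-- The scaling `z^β ↦ 2^|β| z^β` of the multi-indices. -/
def scaleMI : MvPolynomial ℕ ℝ →ₗ[ℝ] MvPolynomial ℕ ℝ :=
  (MvPolynomial.basisMonomials ℕ ℝ).constr ℝ fun β =>
    (2 : ℝ) ^ miNorm β • MvPolynomial.monomial β 1

/-- The scaling `F ↦ 2^|F| F` of the forests. -/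
def scale : HM →ₐ[ℝ] HM :=
  MvPolynomial.aeval fun β : PopMI => (2 : ℝ) ^ miNorm β.1 • MvPolynomial.X β

theorem scale_monomial (F : ForestMI) :
    scale (MvPolynomial.monomial F 1) = (2 : ℝ) ^ F.norm • MvPolynomial.monomial F 1 := by
  rw [scale, MvPolynomial.aeval_monomial, map_one, one_mul]
  simp only [smul_pow, ← pow_mul]
  rw [MvPolynomial.monomial_eq, map_one, one_mul, ForestMI.norm, Finsupp.prod, Finsupp.prod,
    Finset.prod_smul, Finset.prod_pow_eq_pow_sum, Finsupp.sum]
  simp only [mul_comm]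

theorem miNorm_add (α β : ℕ →₀ ℕ) : miNorm (α + β) = miNorm α + miNorm β :=
  Finsupp.sum_add_index' (by simp) (by simp)

theorem miNorm_single (k n : ℕ) : miNorm (Finsupp.single k n) = n :=
  Finsupp.sum_single_index rfl

theorem scaleMI_monomial (β : ℕ →₀ ℕ) (c : ℝ) : scaleMI (MvPolynomial.monomial β c) =
    (2 : ℝ) ^ miNorm β • MvPolynomial.monomial β c := by
  rw [← mul_one c, ← smul_eq_mul, ← MvPolynomial.smul_monomial, map_smul, smul_comm, scaleMI,
    constr_monomial]

/-- `Dbar` trades one `z_k` for one `z_{k-1}`, which preserves the norm. -/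
theorem Dbar_scaleMI (p : MvPolynomial ℕ ℝ) : scaleMI (Dbar p) = Dbar (scaleMI p) := by
  have : scaleMI ∘ₗ Dbar = Dbar ∘ₗ scaleMI := linearMap_ext_monomial fun γ => by
    rw [LinearMap.comp_apply, LinearMap.comp_apply, scaleMI_monomial, map_smul, Dbar_monomial, map_sum,
      Finset.smul_sum]
    refine Finset.sum_congr rfl fun k hk => ?_
    have hle : Finsupp.single k 1 ≤ γ := by
      simpa using Nat.one_le_iff_ne_zero.2 (Finsupp.mem_support_iff.1 (Finset.mem_filter.1 hk).1)
    obtain ⟨δ, rfl⟩ := exists_add_of_le hle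
    rw [scaleMI_monomial, add_tsub_cancel_left, miNorm_add, miNorm_add, miNorm_single, miNorm_single]
  exact DFunLike.congr_fun this p

theorem scaleMI_Dbar_pow (n : ℕ) (p : MvPolynomial ℕ ℝ) :
    scaleMI ((Dbar ^ n) p) = (Dbar ^ n) (scaleMI p) := by
  induction n with
  | zero => simp
  | succ n ih =>
    rw [pow_succ', Module.End.mul_apply, Module.End.mul_apply, Dbar_scaleMI, ih]

theorem scale_toHM (p : MvPolynomial ℕ ℝ) : scale (toHM p) = toHM (scaleMI p) := by
  have : scale.toLinearMap ∘ₗ toHM = toHM ∘ₗ scaleMI := linearMap_ext_monomial fun β => by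
    rw [LinearMap.comp_apply, LinearMap.comp_apply, toHM_monomial, scaleMI_monomial, map_smul,
      toHM_monomial]
    split_ifs
    · simp [scale]
    · simp
  exact DFunLike.congr_fun this p

/-- The coproduct is homogeneous. -/
theorem coproductM_scale (h : HM) :
    coproductM (scale h) = TensorProduct.map scale.toLinearMap scale.toLinearMap (coproductM h) := by
  have : coproductM.comp scale = (Algebra.TensorProduct.map scale scale).comp coproductM :=
    MvPolynomial.algHom_ext fun γ => by
      have hs : scale (MvPolynomial.X γ) = (2 : ℝ) ^ miNorm γ.1 • MvPolynomial.X γ := by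
        simp [scale]
      rw [AlgHom.comp_apply, AlgHom.comp_apply, hs, map_smul, coproductM_X, map_add, map_add,
        map_sum, smul_add, smul_add, Finset.smul_sum]
      congr 1
      · simp [hs, TensorProduct.smul_tmul']
      · refine Finset.sum_congr rfl fun F hF => ?_
        obtain ⟨δ, hδ⟩ := exists_add_of_le (mem_partitions.1 hF).2
        rw [map_smul, Algebra.TensorProduct.map_tmul, scale_monomial, scale_toHM,
          scaleMI_Dbar_pow, scaleMI_monomial, hδ, add_tsub_cancel_left, miNorm_add,
          ForestMI.norm_total, map_smul, map_smul, TensorProduct.smul_tmul_smul, ← pow_add,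
          smul_comm]
  exact DFunLike.congr_fun this h

theorem pairM_scale (u h : HM) : pairM u (scale h) = pairM (scale u) h := by
  have : pairM.compl₂ scale.toLinearMap = pairM ∘ₗ scale.toLinearMap :=
    linearMap_ext_monomial fun F => linearMap_ext_monomial fun G => by
      simp only [LinearMap.compl₂_apply, LinearMap.comp_apply, AlgHom.toLinearMap_apply,
        scale_monomial, map_smul, LinearMap.smul_apply, pairM_monomial,
        MvPolynomial.coeff_monomial]
      by_cases h : G = F
      · simp [h]
      · simp [h]
  exact DFunLike.congr_fun (DFunLike.congr_fun this u) h

/-- Scaling `H` multiplies the pairing by `2^|H|`, while scaling `F ⊗ G` multiplies it by `2^(|F| +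
|G|)`. The two agree by homogeneity and self-adjointness of the scaling, so a nonzero value would
force equal exponents. -/
theorem pairM₂_coproductM_eq_zero {F G H : ForestMI} (h : H.norm ≠ F.norm + G.norm) :
    pairM₂ (MvPolynomial.monomial F 1 ⊗ₜ MvPolynomial.monomial G 1)
      (coproductM (MvPolynomial.monomial H 1)) = 0 := by
  have hs : ∀ x : HM ⊗[ℝ] HM,
      pairM₂ (MvPolynomial.monomial F 1 ⊗ₜ MvPolynomial.monomial G 1)
        (TensorProduct.map scale.toLinearMap scale.toLinearMap x) =
      2 ^ (F.norm + G.norm) *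
        pairM₂ (MvPolynomial.monomial F 1 ⊗ₜ MvPolynomial.monomial G 1) x := by
    intro x
    induction x using TensorProduct.induction_on with
    | zero => simp
    | tmul b c =>
      simp only [TensorProduct.map_tmul, AlgHom.toLinearMap_apply, pairM₂_tmul, pairM_scale,
        scale_monomial, map_smul, LinearMap.smul_apply, smul_eq_mul]
      ring
    | add x y hx hy => simp only [map_add, hx, hy, mul_add]
  have h1 := hs (coproductM (MvPolynomial.monomial H 1))
  rw [← coproductM_scale, scale_monomial, map_smul, map_smul, smul_eq_mul] at h1
  by_contra h0
  exact h (Nat.pow_right_injective le_rfl (by exact_mod_cast mul_right_cancel₀ h0 h1))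

/-- The product `starM` is dual to the coproduct. -/
theorem pairM_starM (u v h : HM) : pairM (starM u v) h = pairM₂ (u ⊗ₜ v) (coproductM h) := by
  have : starM.compr₂ pairM = (TensorProduct.mk ℝ HM HM).compr₂
      ((pairM₂.compl₂ coproductM.toLinearMap)) :=
    linearMap_ext_monomial fun F => linearMap_ext_monomial fun G =>
      linearMap_ext_monomial fun H => by
        simp only [LinearMap.compr₂_apply, LinearMap.compl₂_apply, TensorProduct.mk_apply,
          AlgHom.toLinearMap_apply]
        rw [pairM_symm, pairM_monomial, starM, constr_monomial, constr_monomial,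
          MvPolynomial.coeff_sum]
        simp only [MvPolynomial.coeff_monomial, Finset.sum_ite_eq', Set.Finite.mem_toFinset,
          Set.mem_ofPred_eq]
        split_ifs with h
        · exact mul_div_cancel₀ _ (Nat.cast_ne_zero.2 (ForestMI.sym_pos H).ne')
        -- The norms omitted from the definition of `starM` carry no coefficient.
        · rw [mul_zero, pairM₂_coproductM_eq_zero h]
  exact DFunLike.congr_fun (DFunLike.congr_fun (DFunLike.congr_fun this u) v) h

/-! ### Recursive description of the product -/

/-- Pairing the right leg with `1` applies the counit there. On a generator only `z^γ ⊗ 1` survives,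
since `toHM` has no constant term. -/
theorem starM_one (u : HM) : starM u 1 = u := by
  refine eq_of_pairM_eq fun h => ?_
  let ε : HM →ₐ[ℝ] HM := MvPolynomial.aeval fun _ => 0
  have hε : ∀ k : HM, ε k = MvPolynomial.constantCoeff k • 1 := fun k => by
    rw [MvPolynomial.aeval_zero', Algebra.algebraMap_eq_smul_one]
  have hΔ : (Algebra.TensorProduct.productMap (AlgHom.id ℝ HM) ε).comp coproductM =
      AlgHom.id ℝ HM := MvPolynomial.algHom_ext fun γ => by
    simp [coproductM_X, hε, constantCoeff_toHM]
  have hx : ∀ x : HM ⊗[ℝ] HM, pairM₂ (u ⊗ₜ 1) x =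
      pairM u (Algebra.TensorProduct.productMap (AlgHom.id ℝ HM) ε x) := by
    intro x
    induction x using TensorProduct.induction_on with
    | zero => simp
    | tmul b c => simp [pairM₂_tmul, hε, pairM_one, mul_comm]
    | add x y hx hy => simp only [map_add, hx, hy]
  rw [pairM_starM, hx, ← AlgHom.comp_apply, hΔ, AlgHom.id_apply]

/-- The coefficient of `z^α` in the right factor of the coproduct of `z^γ`. -/
def cofactor (α γ : PopMI) : HM :=
  (if γ = α then 1 else 0) + ∑ F ∈ partitions γ.1,
    ((F.symExt : ℝ)⁻¹ * MvPolynomial.coeff α.1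
      ((Dbar ^ F.card) (MvPolynomial.monomial (γ.1 - F.total) (1 : ℝ)))) •
        MvPolynomial.monomial F (1 : ℝ)

/-- The derivative with respect to `z^α` in the right factor. -/
def pderivRight (α : PopMI) : HM ⊗[ℝ] HM →ₗ[ℝ] HM ⊗[ℝ] HM :=
  TensorProduct.map LinearMap.id (MvPolynomial.pderiv α).toLinearMap

theorem pderivRight_tmul (α : PopMI) (a b : HM) :
    pderivRight α (a ⊗ₜ b) = a ⊗ₜ MvPolynomial.pderiv α b := by
  simp [pderivRight]

theorem pderivRight_mul (α : PopMI) (x y : HM ⊗[ℝ] HM) :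
    pderivRight α (x * y) = pderivRight α x * y + x * pderivRight α y := by
  induction x using TensorProduct.induction_on with
  | zero => simp
  | add x x' hx hx' => simp only [add_mul, map_add, hx, hx']; abel
  | tmul a b =>
    induction y using TensorProduct.induction_on with
    | zero => simp
    | add y y' hy hy' => simp only [mul_add, map_add, hy, hy']; abel
    | tmul c d =>
      simp only [pderivRight_tmul, Algebra.TensorProduct.tmul_mul_tmul, Derivation.leibniz,
        smul_eq_mul, TensorProduct.tmul_add, mul_comm d, add_comm]

/-- The right legs have degree at most one, so differentiation makes them scalars, which move to the
left leg. -/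
theorem pderivRight_coproductM_X (α γ : PopMI) :
    pderivRight α (coproductM (MvPolynomial.X γ)) = cofactor α γ ⊗ₜ 1 := by
  rw [coproductM_X, cofactor, map_add, map_add, map_sum, TensorProduct.add_tmul,
    TensorProduct.sum_tmul]
  congr 1
  · rw [pderivRight_tmul, pderivRight_tmul, MvPolynomial.pderiv_X, Pi.single_apply]
    rcases eq_or_ne γ α with rfl | h
    · simp
    · simp [h]
  · refine Finset.sum_congr rfl fun F _ => ?_
    rw [map_smul, pderivRight_tmul, pderiv_toHM, TensorProduct.tmul_smul, smul_smul,
      TensorProduct.smul_tmul']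

/-- The coproduct is multiplicative, so the Leibniz rule differentiates one factor and leaves the
coproduct of the others. Selecting one factor is an unshuffle with `primitiveExt` on one leg. -/
theorem pderivRight_coproductM (α : PopMI) (K : HM) : pderivRight α (coproductM K) =
    conv (primitiveExt fun γ => cofactor α γ ⊗ₜ[ℝ] (1 : HM)) coproductM.toLinearMap K := by
  induction K using polynomial_induction with
  | one =>
    rw [conv_one, primitiveExt_one, map_one, Algebra.TensorProduct.one_def, pderivRight_tmul]
    simp
  | smul c u ih => simp only [map_smul, ih]
  | add u v hu hv => simp only [map_add, hu, hv]
  | X_mul γ K ih =>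
    -- Once `γ` is the selected factor, nothing else may be selected: a multiple of the counit
    -- remains, the unit for convolution.
    have h1 : (primitiveExt fun γ => cofactor α γ ⊗ₜ[ℝ] (1 : HM)) ∘ₗ mulX γ =
        LinearMap.mulLeft ℝ (cofactor α γ ⊗ₜ[ℝ] (1 : HM)) ∘ₗ counit PopMI (HM ⊗[ℝ] HM) :=
      LinearMap.ext fun u => by
        simp [primitiveExt_X_mul, counit, MvPolynomial.aeval_zero',
          Algebra.algebraMap_eq_smul_one]
    have h2 : coproductM.toLinearMap ∘ₗ mulX γ =
        LinearMap.mulLeft ℝ (coproductM (MvPolynomial.X γ)) ∘ₗ coproductM.toLinearMap :=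
      LinearMap.ext fun u => by simp
    rw [map_mul, pderivRight_mul, pderivRight_coproductM_X, ih, conv_X_mul, h1, h2,
      conv_mulLeft_left, conv_comm (counit _ _), conv_counit, conv_mulLeft_right]
    rfl

/-- Grafting onto `z^α`: the forest `z^β₁ ⋯ z^βₙ` is sent to `z^(β₁ + ⋯ + βₙ) Dⁿ z^α`. -/
def graftMI (α : PopMI) : HM →ₗ[ℝ] HM :=
  toHM ∘ₗ insertion (MvPolynomial.monomial α.1 1)

/-- On a forest `F`, the weight `S(F) / S_ext(F)` is `symMI F.total`. Adjointness of `Dⁿ` and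
`Dbarⁿ` replaces `symMI α` by `symMI (γ - F.total)`, and the two combine to `symMI γ`. -/
theorem pairM_cofactor (α γ : PopMI) (u : HM) : symMI α.1 * pairM u (cofactor α γ) =
    symMI γ.1 * MvPolynomial.coeff γ.1 (insertion (MvPolynomial.monomial α.1 1) u) := by
  have : (symMI α.1 : ℝ) • pairM.flip (cofactor α γ) = (symMI γ.1 : ℝ) •
      (MvPolynomial.lcoeff ℝ γ.1 ∘ₗ insertion (MvPolynomial.monomial α.1 1)) :=
    linearMap_ext_monomial fun (F : ForestMI) => by
      simp only [LinearMap.smul_apply, LinearMap.flip_apply, LinearMap.comp_apply, smul_eq_mul,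
        MvPolynomial.lcoeff_apply, insertion_monomial, MvPolynomial.coeff_monomial_mul',
        pairM_monomial, cofactor, MvPolynomial.coeff_add, MvPolynomial.coeff_sum,
        MvPolynomial.coeff_smul, MvPolynomial.coeff_monomial, mul_ite, mul_one, mul_zero,
        Finset.sum_ite_eq', one_mul, mem_partitions]
      -- The empty forest is excluded from `partitions`; the separate term `1 ⊗ z^γ` accounts for
      -- it.
      rcases eq_or_ne F 0 with rfl | hF
      · rcases eq_or_ne γ α with rfl | h
        · simp [ForestMI.total, ForestMI.sym, ForestMI.card]
        · have h' : α.1 ≠ γ.1 := fun h' => h (Subtype.ext h'.symm)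
          simp [ForestMI.total, ForestMI.sym, ForestMI.card, h, h', MvPolynomial.coeff_monomial]
      · have h0 : MvPolynomial.coeff F (if γ = α then 1 else 0 : HM) = 0 := by
          split_ifs
          · rw [MvPolynomial.coeff_one, if_neg (Ne.symm hF)]
          · simp
        rw [h0, zero_add]
        by_cases hle : F.total ≤ γ.1
        · obtain ⟨δ, hδ⟩ := exists_add_of_le hle
          have hs : (F.symExt : ℝ) ≠ 0 := Nat.cast_ne_zero.2 (ForestMI.symExt_pos F).ne'
          have key := symMI_mul_coeff_raise_pow F.card α.1 δ
          rw [if_pos ⟨hF, hle⟩, if_pos hle, hδ, add_tsub_cancel_left, symMI_add,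
            ForestMI.sym_eq, Nat.cast_mul, Nat.cast_mul, mul_assoc (symMI F.total : ℝ), key]
          field_simp
        · rw [if_neg fun h => hle h.2, if_neg hle]
          simp
  exact DFunLike.congr_fun this u

/-- Grafting onto `z^α` lands in degree one, so only the degree one part of `k` is seen. -/
theorem pairM_graftMI (α : PopMI) (u k : HM) :
    pairM (graftMI α u) k = symMI α.1 * pairM u (primitiveExt (cofactor α) k) := by
  induction k using polynomial_induction with
  | one =>
    rw [pairM_symm, pairM_one, graftMI, LinearMap.comp_apply, constantCoeff_toHM, primitiveExt_one]
    simp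
  | smul c u ih => simp only [map_smul, ih, smul_eq_mul]; ring
  | add u v hu hv => simp only [map_add, hu, hv, mul_add]
  | X_mul γ k =>
    rw [pairM_symm, pairM_X_mul, graftMI, LinearMap.comp_apply, pderiv_toHM, map_smul, pairM_symm,
      pairM_one, primitiveExt_X_mul, map_smul, smul_eq_mul, smul_eq_mul,
      mul_left_comm (symMI α.1 : ℝ), pairM_cofactor]
    ring

/-- The left leg is a forest product, and pairing `u` with a product unshuffles `u`. -/
theorem pairM₂_tmul_one_mul (u v a : HM) (x : HM ⊗[ℝ] HM) :
    pairM₂ (u ⊗ₜ v) (a ⊗ₜ 1 * x) =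
      conv (pairM.flip a) (pairM₂.flip x ∘ₗ (TensorProduct.mk ℝ HM HM).flip v) u := by
  simp only [conv_apply]
  induction x using TensorProduct.induction_on with
  | zero => simp
  | add x y hx hy =>
    simp only [mul_add, map_add, hx, hy, LinearMap.add_comp, TensorProduct.map_add_right,
      LinearMap.add_apply]
  | tmul b c =>
    rw [Algebra.TensorProduct.tmul_mul_tmul, one_mul, pairM₂_tmul, ← pairM₂_unshuffle]
    generalize unshuffle PopMI u = y
    induction y using TensorProduct.induction_on with
    | zero => simp
    | add x y hx hy => simp only [map_add, LinearMap.add_apply, add_mul, hx, hy]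
    | tmul d e => simp [pairM₂_tmul, mul_assoc]

/-- The recursive description of the product in its right argument. -/
theorem starM_X_mul (u v : HM) (α : PopMI) :
    starM u (MvPolynomial.X α * v) = conv (graftMI α) (starM.flip v) u := by
  refine eq_of_pairM_eq fun K => ?_
  have h1 : ∀ x : HM ⊗[ℝ] HM, pairM₂ (u ⊗ₜ (MvPolynomial.X α * v)) x =
      symMI α.1 * pairM₂ (u ⊗ₜ v) (pderivRight α x) := by
    intro x
    induction x using TensorProduct.induction_on with
    | zero => simp
    | add x y hx hy => simp only [map_add, mul_add, hx, hy]
    | tmul b c =>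
      rw [pderivRight_tmul, pairM₂_tmul, pairM₂_tmul, pairM_X_mul]
      ring
  have h2 : ∀ x : HM ⊗[ℝ] HM, pairM (LinearMap.mul' ℝ HM x) K = pairM₂ x (unshuffle PopMI K) := by
    intro x
    induction x using TensorProduct.induction_on with
    | zero => simp
    | add x y hx hy => simp only [map_add, LinearMap.add_apply, hx, hy]
    | tmul b c => rw [LinearMap.mul'_apply, pairM_mul]
  have h3 : (primitiveExt fun γ => cofactor α γ ⊗ₜ[ℝ] (1 : HM)) =
      (TensorProduct.mk ℝ HM HM).flip 1 ∘ₗ primitiveExt (cofactor α) := by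
    refine LinearMap.ext fun k => ?_
    induction k using polynomial_induction with
    | one => simp [primitiveExt_one]
    | smul c u ih => simp only [map_smul, ih]
    | add u v hu hv => simp only [map_add, hu, hv]
    | X_mul γ k => simp [primitiveExt_X_mul, TensorProduct.smul_tmul']
  -- Both sides become sums over the unshuffles of `K` (Leibniz rule) and of `u` (product in the
  -- left leg), compared on pure tensors.
  rw [pairM_starM, h1, pderivRight_coproductM, conv_apply, conv_apply, h2, h3]
  generalize unshuffle PopMI K = y
  induction y using TensorProduct.induction_on with
  | zero => simp
  | add x y hx hy => simp only [map_add, mul_add, hx, hy]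
  | tmul b c =>
    have h4 : TensorProduct.map ((TensorProduct.mk ℝ HM HM).flip 1 ∘ₗ primitiveExt (cofactor α))
        coproductM.toLinearMap (b ⊗ₜ c) =
        (primitiveExt (cofactor α) b ⊗ₜ[ℝ] (1 : HM)) ⊗ₜ coproductM c := rfl
    rw [h4, LinearMap.mul'_apply, pairM₂_tmul_one_mul, conv_apply]
    generalize unshuffle PopMI u = x
    induction x using TensorProduct.induction_on with
    | zero => simp
    | add x y hx hy => simp only [map_add, LinearMap.add_apply, mul_add, hx, hy]
    | tmul d e => simp [pairM₂_tmul, pairM_graftMI, pairM_starM, mul_assoc]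

/-! ### Elementary differentials -/

/-- Both are products over the vertices of `f^(k)`, `k` being the number of branches. The root is
kept apart, as its degree changes along the planar recursion. -/
theorem elemMI_phi (f : ℝ → ℝ) (τ : RTree) : elemMI f τ.phi = elemTree f τ := by
  funext y
  induction τ using Quot.ind with | _ t =>
  have hadd : ∀ α β : ℕ →₀ ℕ, ((α + β).prod fun k b => iteratedDeriv k f y ^ b) =
      (α.prod fun k b => iteratedDeriv k f y ^ b) * β.prod fun k b => iteratedDeriv k f y ^ b :=
    fun α β => Finsupp.prod_add_index' (by simp) (by intros; rw [pow_add])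
  have hsingle : ∀ k : ℕ, ((Finsupp.single k 1).prod fun k b => iteratedDeriv k f y ^ b) =
      iteratedDeriv k f y := fun k => by simp
  have hbelow : ∀ t : PlanarTree,
      (t.phiBelow.prod fun k b => iteratedDeriv k f y ^ b) = t.elemBelow f y := by
    intro t
    induction t with
    | bullet => simp [PlanarTree.phiBelow, PlanarTree.elemBelow]
    | adjoin a t iha iht =>
      simp only [PlanarTree.phiBelow, PlanarTree.elemBelow, hadd, hsingle, iha, iht]
  change (t.phi.prod fun k b => iteratedDeriv k f y ^ b) = _
  rw [PlanarTree.phi, hadd, hsingle, hbelow]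
  rfl

theorem elemField_monomial (f φ : ℝ → ℝ) (F : ForestMI) :
    elemField f φ (MvPolynomial.monomial F 1) =
      fun y => (F.prod fun β r => elemMI f β y ^ r) * iteratedDeriv F.card φ y :=
  constr_monomial _ _

theorem elemField_one (f φ : ℝ → ℝ) : elemField f φ 1 = φ := by
  have := elemField_monomial f φ 0
  simpa [ForestMI.card] using this

/-- The extra derivative is applied to `φ` first, by `φ^(n+1) = (φ')^(n)`. -/
theorem elemField_X_mul (f φ : ℝ → ℝ) (β : PopMI) (u : HM) :
    elemField f φ (MvPolynomial.X β * u) = elemMI f β * elemField f (deriv φ) u := by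
  have : elemField f φ ∘ₗ mulX β =
      LinearMap.mulLeft ℝ (elemMI f β) ∘ₗ elemField f (deriv φ) :=
    linearMap_ext_monomial fun F => by
      rw [LinearMap.comp_apply, mulX_apply, X_mul_monomial, LinearMap.comp_apply,
        LinearMap.mulLeft_apply, elemField_monomial, elemField_monomial]
      funext y
      rw [ForestMI.card_single_add, iteratedDeriv_succ', Pi.mul_apply,
        Finsupp.prod_add_index' (by simp) (by intros; rw [pow_add]),
        Finsupp.prod_single_index (by simp), pow_one, mul_assoc]
  exact DFunLike.congr_fun this u

theorem elemField_comp_mulX (f φ : ℝ → ℝ) (β : PopMI) :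
    elemField f φ ∘ₗ mulX β = LinearMap.mulLeft ℝ (elemMI f β) ∘ₗ elemField f (deriv φ) :=
  LinearMap.ext fun u => elemField_X_mul f φ β u

theorem contDiff_deriv {φ : ℝ → ℝ} (hφ : ContDiff ℝ ∞ φ) : ContDiff ℝ ∞ (deriv φ) :=
  (contDiff_infty_iff_deriv.1 hφ).2

theorem contDiff_iteratedDeriv {f : ℝ → ℝ} (hf : ContDiff ℝ ∞ f) (k : ℕ) :
    ContDiff ℝ ∞ (iteratedDeriv k f) := by
  induction k with
  | zero => simpa using hf
  | succ k ih => rw [iteratedDeriv_succ]; exact contDiff_deriv ih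

theorem contDiff_elemMI {f : ℝ → ℝ} (hf : ContDiff ℝ ∞ f) (β : PopMI) :
    ContDiff ℝ ∞ (elemMI f β) :=
  contDiff_prod fun k _ => (contDiff_iteratedDeriv hf k).pow _

theorem contDiff_elemField {f φ : ℝ → ℝ} (hf : ContDiff ℝ ∞ f) (hφ : ContDiff ℝ ∞ φ) (u : HM) :
    ContDiff ℝ ∞ (elemField f φ u) := by
  induction u using polynomial_induction generalizing φ with
  | one => rwa [elemField_one]
  | smul c u ih => rw [map_smul]; exact (ih hφ).const_smul c
  | add u v hu hv => rw [map_add]; exact (hu hφ).add (hv hφ)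
  | X_mul β u ih =>
    rw [elemField_X_mul]
    exact (contDiff_elemMI hf β).mul (ih (contDiff_deriv hφ))

theorem differentiable_of_contDiff {φ : ℝ → ℝ} (hφ : ContDiff ℝ ∞ φ) : Differentiable ℝ φ :=
  (contDiff_infty_iff_deriv.1 hφ).1

theorem deriv_add_fun {φ ψ : ℝ → ℝ} (hφ : ContDiff ℝ ∞ φ) (hψ : ContDiff ℝ ∞ ψ) :
    deriv (φ + ψ) = deriv φ + deriv ψ := by
  funext y
  exact deriv_add (differentiable_of_contDiff hφ y) (differentiable_of_contDiff hψ y)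

theorem deriv_mul_fun {φ ψ : ℝ → ℝ} (hφ : ContDiff ℝ ∞ φ) (hψ : ContDiff ℝ ∞ ψ) :
    deriv (φ * ψ) = deriv φ * ψ + φ * deriv ψ := by
  funext y
  exact deriv_mul (differentiable_of_contDiff hφ y) (differentiable_of_contDiff hψ y)

theorem deriv_const_smul_fun (c : ℝ) (φ : ℝ → ℝ) : deriv (c • φ) = c • deriv φ :=
  funext fun _ => deriv_const_smul_field c φ

theorem elemField_add {f φ ψ : ℝ → ℝ} (hφ : ContDiff ℝ ∞ φ) (hψ : ContDiff ℝ ∞ ψ) (u : HM) :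
    elemField f (φ + ψ) u = elemField f φ u + elemField f ψ u := by
  induction u using polynomial_induction generalizing φ ψ with
  | one => simp only [elemField_one]
  | smul c u ih => simp only [map_smul, ih hφ hψ, smul_add]
  | add u v hu hv => simp only [map_add, hu hφ hψ, hv hφ hψ]; abel
  | X_mul β u ih =>
    rw [elemField_X_mul, elemField_X_mul, elemField_X_mul, deriv_add_fun hφ hψ,
      ih (contDiff_deriv hφ) (contDiff_deriv hψ), mul_add]

theorem elemField_const_smul {f : ℝ → ℝ} (c : ℝ) (φ : ℝ → ℝ) (u : HM) :
    elemField f (c • φ) u = c • elemField f φ u := by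
  induction u using polynomial_induction generalizing φ with
  | one => simp only [elemField_one]
  | smul d u ih => rw [map_smul, map_smul, ih, smul_comm]
  | add u v hu hv => simp only [map_add, hu, hv, smul_add]
  | X_mul β u ih =>
    rw [elemField_X_mul, elemField_X_mul, deriv_const_smul_fun, ih, mul_smul_comm]

/-- The Leibniz rule for elementary vector fields. -/
theorem conv_elemField {f φ ψ : ℝ → ℝ} (hφ : ContDiff ℝ ∞ φ) (hψ : ContDiff ℝ ∞ ψ) (u : HM) :
    conv (elemField f φ) (elemField f ψ) u = elemField f (φ * ψ) u := by
  induction u using polynomial_induction generalizing φ ψ with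
  | one => simp only [conv_one, elemField_one]
  | smul c u ih => simp only [map_smul, ih hφ hψ]
  | add u v hu hv => simp only [map_add, hu hφ hψ, hv hφ hψ]
  | X_mul β u ih =>
    have hφ' := contDiff_deriv hφ
    have hψ' := contDiff_deriv hψ
    rw [conv_X_mul, elemField_X_mul, elemField_comp_mulX, elemField_comp_mulX, conv_mulLeft_left,
      conv_mulLeft_right, deriv_mul_fun hφ hψ,
      elemField_add (φ := deriv φ * ψ) (ψ := φ * deriv ψ) (hφ'.mul hψ) (hφ.mul hψ'),
      LinearMap.comp_apply, LinearMap.comp_apply, ih hφ' hψ, ih hφ hψ', mul_add]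
    rfl

/-! ### Evaluation of multi-indices and of insertions -/

/-- The evaluation `z_k ↦ f^(k)`. -/
def evalMI (f : ℝ → ℝ) : MvPolynomial ℕ ℝ →ₐ[ℝ] (ℝ → ℝ) :=
  MvPolynomial.aeval fun k => iteratedDeriv k f

theorem evalMI_monomial (f : ℝ → ℝ) (β : PopMI) :
    evalMI f (MvPolynomial.monomial β.1 1) = elemMI f β := by
  funext y
  rw [evalMI, MvPolynomial.aeval_monomial, map_one, one_mul, elemMI, Finsupp.prod, Finsupp.prod,
    Finset.prod_apply]
  rfl

theorem contDiff_evalMI {f : ℝ → ℝ} (hf : ContDiff ℝ ∞ f) (p : MvPolynomial ℕ ℝ) :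
    ContDiff ℝ ∞ (evalMI f p) := by
  induction p using polynomial_induction with
  | one => rw [map_one]; exact contDiff_const
  | smul c u ih => rw [map_smul]; exact ih.const_smul c
  | add u v hu hv => rw [map_add]; exact hu.add hv
  | X_mul k u ih =>
    rw [map_mul, evalMI, MvPolynomial.aeval_X]
    exact (contDiff_iteratedDeriv hf k).mul ih

/-- Both sides obey the Leibniz rule and send `z_k` to `f^(k+1)`. -/
theorem evalMI_raise {f : ℝ → ℝ} (hf : ContDiff ℝ ∞ f) (p : MvPolynomial ℕ ℝ) :
    evalMI f (raise p) = deriv (evalMI f p) := by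
  induction p using polynomial_induction with
  | one =>
    rw [Derivation.map_one_eq_zero, map_zero, map_one]
    exact (funext fun y => deriv_const y (1 : ℝ)).symm
  | smul c u ih =>
    rw [Derivation.map_smul, map_smul, map_smul, ih, deriv_const_smul_fun]
  | add u v hu hv =>
    rw [map_add, map_add, map_add, hu, hv,
      deriv_add_fun (contDiff_evalMI hf u) (contDiff_evalMI hf v)]
  | X_mul k u ih =>
    have hX : ∀ k, evalMI f (MvPolynomial.X k) = iteratedDeriv k f := fun k => by simp [evalMI]
    rw [Derivation.leibniz, raise_X, smul_eq_mul, smul_eq_mul, map_add, map_mul, map_mul, map_mul,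
      ih, hX, hX, deriv_mul_fun (contDiff_iteratedDeriv hf k) (contDiff_evalMI hf u),
      ← iteratedDeriv_succ, add_comm, mul_comm (evalMI f u)]

theorem evalMI_insertion {f : ℝ → ℝ} (hf : ContDiff ℝ ∞ f) (p : MvPolynomial ℕ ℝ) (u : HM) :
    evalMI f (insertion p u) = elemField f (evalMI f p) u := by
  induction u using polynomial_induction generalizing p with
  | one => rw [insertion_one, elemField_one]
  | smul c u ih => simp only [map_smul, ih]
  | add u v hu hv => simp only [map_add, hu, hv]
  | X_mul β u ih =>
    rw [insertion_X_mul, elemField_X_mul, map_mul, ih, evalMI_raise hf, evalMI_monomial]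

/-! ### Insertions into populated multi-indices are populated -/

/-- The weight of the population condition. -/
def popWeight (k : ℕ) : ℤ := 1 - k

theorem populated_iff (β : ℕ →₀ ℕ) : Populated β ↔ Finsupp.weight popWeight β = 1 := by
  rw [Populated, Finsupp.weight_apply]
  simp only [popWeight, nsmul_eq_mul, mul_comm]

theorem isWeightedHomogeneous_raise {p : MvPolynomial ℕ ℝ} {n : ℤ}
    (hp : p.IsWeightedHomogeneous popWeight n) :
    (raise p).IsWeightedHomogeneous popWeight (n - 1) := by
  rw [p.as_sum, map_sum]
  refine MvPolynomial.IsWeightedHomogeneous.sum _ _ _ fun β hβ => ?_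
  rw [raise, MvPolynomial.mkDerivation_monomial, Finsupp.sum, Finset.smul_sum]
  refine MvPolynomial.IsWeightedHomogeneous.sum _ _ _ fun k hk => ?_
  rw [MvPolynomial.X, smul_eq_mul, MvPolynomial.monomial_mul, MvPolynomial.smul_monomial]
  refine MvPolynomial.isWeightedHomogeneous_monomial _ _ _ ?_
  have hle : Finsupp.single k 1 ≤ β := by
    simpa using Nat.one_le_iff_ne_zero.2 (Finsupp.mem_support_iff.1 hk)
  have hw := hp (MvPolynomial.mem_support_iff.1 hβ)
  obtain ⟨δ, rfl⟩ := exists_add_of_le hle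
  rw [add_tsub_cancel_left]
  simp only [map_add, Finsupp.weight_single, popWeight, one_smul] at hw ⊢
  push_cast
  linarith

/-- The `n` populated multi-indices add weight `n` and `Dⁿ` removes it. Hence `toHM`, which discards
unpopulated monomials, loses nothing when grafting. -/
theorem isWeightedHomogeneous_insertion (F : ForestMI) {p : MvPolynomial ℕ ℝ}
    (hp : p.IsWeightedHomogeneous popWeight 1) :
    (insertion p (MvPolynomial.monomial F 1)).IsWeightedHomogeneous popWeight 1 := by
  have hraise : ∀ n : ℕ, ((raise.toLinearMap ^ n) p).IsWeightedHomogeneous popWeight (1 - n) := by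
    intro n
    induction n with
    | zero => simpa using hp
    | succ n ih =>
      rw [pow_succ', Module.End.mul_apply]
      have := isWeightedHomogeneous_raise ih
      rwa [show (1 : ℤ) - n - 1 = 1 - (n + 1 : ℕ) by push_cast; ring] at this
  have htotal : Finsupp.weight popWeight F.total = F.card := by
    rw [ForestMI.total, map_finsuppSum, ForestMI.card, Finsupp.sum, Finsupp.sum]
    push_cast
    refine Finset.sum_congr rfl fun β _ => ?_
    rw [map_nsmul, (populated_iff _).1 β.2]
    simp
  rw [insertion_monomial]
  convert (MvPolynomial.isWeightedHomogeneous_monomial _ _ (1 : ℝ) htotal).mul (hraise F.card)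
    using 1
  ring

/-- The evaluation of a combination of forests, without the derivatives of the test function. -/
def evalForest (f : ℝ → ℝ) : HM →ₐ[ℝ] (ℝ → ℝ) := MvPolynomial.aeval (elemMI f)

theorem evalForest_toHM (f : ℝ → ℝ) {p : MvPolynomial ℕ ℝ}
    (hp : p.IsWeightedHomogeneous popWeight 1) : evalForest f (toHM p) = evalMI f p := by
  rw [p.as_sum, map_sum, map_sum, map_sum]
  refine Finset.sum_congr rfl fun β hβ => ?_
  have hpop : Populated β := (populated_iff β).2 (hp (MvPolynomial.mem_support_iff.1 hβ))
  rw [← mul_one (p.coeff β), ← smul_eq_mul, ← MvPolynomial.smul_monomial, map_smul, map_smul,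
    map_smul, toHM_monomial, dif_pos hpop, evalForest, MvPolynomial.aeval_X,
    ← evalMI_monomial]

theorem evalForest_graftMI {f : ℝ → ℝ} (hf : ContDiff ℝ ∞ f) (α : PopMI) (u : HM) :
    evalForest f (graftMI α u) = elemField f (elemMI f α) u := by
  have : (evalForest f).toLinearMap ∘ₗ graftMI α = elemField f (elemMI f α) :=
    linearMap_ext_monomial fun F => by
      rw [LinearMap.comp_apply, graftMI, LinearMap.comp_apply, AlgHom.toLinearMap_apply,
        evalForest_toHM, evalMI_insertion hf, evalMI_monomial]
      exact isWeightedHomogeneous_insertion F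
        (MvPolynomial.isWeightedHomogeneous_monomial _ _ _ ((populated_iff _).1 α.2))
  exact DFunLike.congr_fun this u

/-- Forests in the image of `toHM` have length one, hence exactly one derivative of `φ`. -/
theorem elemField_toHM_mul (f φ : ℝ → ℝ) (p : MvPolynomial ℕ ℝ) (u : HM) :
    elemField f φ (toHM p * u) = evalForest f (toHM p) * elemField f (deriv φ) u := by
  have : (elemField f φ) ∘ₗ LinearMap.mulRight ℝ u ∘ₗ toHM =
      LinearMap.mulRight ℝ (elemField f (deriv φ) u) ∘ₗ (evalForest f).toLinearMap ∘ₗ toHM :=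
    linearMap_ext_monomial fun β => by
      simp only [LinearMap.comp_apply, LinearMap.mulRight_apply, AlgHom.toLinearMap_apply,
        toHM_monomial]
      split_ifs
      · rw [elemField_X_mul, evalForest, MvPolynomial.aeval_X]
      · simp
  exact DFunLike.congr_fun this p

/-- The composition of elementary vector fields. -/
theorem elemField_starM {f φ : ℝ → ℝ} (hf : ContDiff ℝ ∞ f) (hφ : ContDiff ℝ ∞ φ) (u v : HM) :
    elemField f φ (starM u v) = elemField f (elemField f φ v) u := by
  induction v using polynomial_induction generalizing φ u with
  | one => rw [starM_one, elemField_one]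
  | smul c v ih => rw [map_smul, map_smul, map_smul, ih hφ, elemField_const_smul]
  | add v w hv hw =>
    rw [map_add, map_add, map_add, hv hφ, hw hφ,
      elemField_add (contDiff_elemField hf hφ v) (contDiff_elemField hf hφ w)]
  | X_mul α v ih =>
    have hφ' := contDiff_deriv hφ
    -- The recursion for `starM` and the Leibniz rule for `elemMI f α * elemField f (deriv φ) v`
    -- unshuffle the same `u`, so pure tensors suffice.
    rw [starM_X_mul, elemField_X_mul,
      ← conv_elemField (contDiff_elemMI hf α) (contDiff_elemField hf hφ' v), conv_apply, conv_apply]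
    generalize unshuffle PopMI u = x
    induction x using TensorProduct.induction_on with
    | zero => simp
    | add x y hx hy => simp only [map_add, hx, hy]
    | tmul a b =>
      rw [TensorProduct.map_tmul, TensorProduct.map_tmul, LinearMap.mul'_apply,
        LinearMap.mul'_apply, LinearMap.flip_apply, ← ih hφ', ← evalForest_graftMI hf]
      exact elemField_toHM_mul _ _ _ _

/-! ### Sums over all the ways of distributing a forest -/

section Distribution

variable {X W W' A B : Type} [CommRing A] [Algebra ℝ A] [CommRing B]
  [Algebra ℝ B]

theorem constr_single (p : (W → Multiset X) → A) (h : W → Multiset X) :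
    (AddMonoidAlgebra.basis (W → Multiset X) ℝ).constr ℝ p (AddMonoidAlgebra.single h 1) =
      p h := by
  rw [← AddMonoidAlgebra.basis_apply, Module.Basis.constr_basis]

variable [Fintype W] [Fintype W']

/-- The sum of all the distributions of the elements of a multiset over the set `W`. -/
def distributions (W X : Type) [Fintype W] :
    MvPolynomial X ℝ →ₐ[ℝ] AddMonoidAlgebra ℝ (W → Multiset X) :=
  MvPolynomial.aeval fun b => ∑ w, AddMonoidAlgebra.single (Pi.single w {b}) 1

/-- The linear map sending the multiset of the `σ i`, `i ∈ ι`, to the sum over all maps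
`v : ι → W` of the value of `p` at the function sending `w` to the multiset of the `σ i` with
`v i = w`. -/
def distSum (p : (W → Multiset X) → A) : MvPolynomial X ℝ →ₗ[ℝ] A :=
  (AddMonoidAlgebra.basis (W → Multiset X) ℝ).constr ℝ p ∘ₗ (distributions W X).toLinearMap

theorem distSum_one (p : (W → Multiset X) → A) : distSum p 1 = p 0 := by
  rw [distSum, LinearMap.comp_apply, AlgHom.toLinearMap_apply, map_one, AddMonoidAlgebra.one_def,
    constr_single]

theorem distSum_X_mul (p : (W → Multiset X) → A) (b : X) (u : MvPolynomial X ℝ) :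
    distSum p (MvPolynomial.X b * u) = ∑ w, distSum (fun h => p (Pi.single w {b} + h)) u := by
  have key : ∀ (m : W → Multiset X) (x : AddMonoidAlgebra ℝ (W → Multiset X)),
      (AddMonoidAlgebra.basis (W → Multiset X) ℝ).constr ℝ p (AddMonoidAlgebra.single m 1 * x) =
        (AddMonoidAlgebra.basis (W → Multiset X) ℝ).constr ℝ (fun h => p (m + h)) x := by
    intro m x
    have : (AddMonoidAlgebra.basis (W → Multiset X) ℝ).constr ℝ p ∘ₗ
        LinearMap.mulLeft ℝ (AddMonoidAlgebra.single m 1) =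
        (AddMonoidAlgebra.basis (W → Multiset X) ℝ).constr ℝ (fun h => p (m + h)) :=
      (AddMonoidAlgebra.basis (W → Multiset X) ℝ).ext fun h => by
        rw [AddMonoidAlgebra.basis_apply, LinearMap.comp_apply, LinearMap.mulLeft_apply,
          AddMonoidAlgebra.single_mul_single, one_mul, constr_single, constr_single]
    exact DFunLike.congr_fun this x
  simp only [distSum, LinearMap.comp_apply, AlgHom.toLinearMap_apply, map_mul]
  simp only [← key]
  rw [← map_sum, ← Finset.sum_mul]
  simp [distributions]

theorem distSum_comp_mulX (p : (W → Multiset X) → A) (b : X) :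
    distSum p ∘ₗ mulX b = ∑ w, distSum (fun h => p (Pi.single w {b} + h)) :=
  LinearMap.ext fun u => by
    rw [LinearMap.comp_apply, mulX_apply, distSum_X_mul, LinearMap.sum_apply]

/-- Expanding the product of sums over `W` gives one term for each map `v`, recording its fibres. -/
theorem distSum_prod {ι : Type} [Fintype ι] (p : (W → Multiset X) → A) (σ : ι → X) :
    distSum p (∏ i, MvPolynomial.X (σ i)) =
      ∑ v : ι → W, p fun w => (Finset.univ.filter (v · = w)).val.map σ := by
  have hfib : ∀ v : ι → W, ∏ i, AddMonoidAlgebra.single (Pi.single (v i) {σ i}) (1 : ℝ) =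
      (AddMonoidAlgebra.single (fun w => (Finset.univ.filter (v · = w)).val.map σ) 1 :
        AddMonoidAlgebra ℝ (W → Multiset X)) := by
    intro v
    have hsum : (fun w => (Finset.univ.filter (v · = w)).val.map σ) =
        ∑ i, (Pi.single (v i) {σ i} : W → Multiset X) := by
      funext w
      rw [Finset.sum_apply]
      simp only [Pi.single_apply, eq_comm (a := w)]
      rw [← Finset.sum_filter, ← Multiset.sum_map_singleton (Multiset.map σ _), Multiset.map_map]
      rfl
    rw [hsum]
    have := map_prod (AddMonoidAlgebra.of ℝ (W → Multiset X))
      (fun i => Multiplicative.ofAdd (Pi.single (v i) {σ i})) Finset.univ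
    exact this.symm
  rw [distSum, LinearMap.comp_apply, AlgHom.toLinearMap_apply, map_prod]
  simp only [distributions, MvPolynomial.aeval_X]
  rw [Finset.prod_univ_sum, map_sum, Fintype.piFinset_univ]
  exact Finset.sum_congr rfl fun v _ => by rw [hfib, constr_single]

theorem comp_distSum (g : A →ₗ[ℝ] B) (p : (W → Multiset X) → A) :
    g ∘ₗ distSum p = distSum (g ∘ p) := by
  rw [distSum, ← LinearMap.comp_assoc, distSum]
  congr 1
  exact (AddMonoidAlgebra.basis (W → Multiset X) ℝ).ext fun h => by
    rw [LinearMap.comp_apply, Module.Basis.constr_basis, Module.Basis.constr_basis]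
    rfl

/-- Distributing over a disjoint union means deciding which elements go to each side, which is the
unshuffle, and then distributing each part. -/
theorem distSum_sum (p : (W → Multiset X) → A) (q : (W' → Multiset X) → A) :
    distSum (fun h : W ⊕ W' → Multiset X => p (h ∘ Sum.inl) * q (h ∘ Sum.inr)) =
      conv (distSum p) (distSum q) := by
  refine LinearMap.ext fun u => ?_
  induction u using polynomial_induction generalizing p q with
  | one => rw [distSum_one, conv_one, distSum_one, distSum_one]; rfl
  | smul c u ih => simp only [map_smul, ih]
  | add u v hu hv => simp only [map_add, hu, hv]
  | X_mul b u ih =>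
    rw [distSum_X_mul, conv_X_mul, distSum_comp_mulX, distSum_comp_mulX, conv_sum_left,
      conv_sum_right, LinearMap.sum_apply, LinearMap.sum_apply, Fintype.sum_sum_type]
    congr 1
    all_goals
      refine Finset.sum_congr rfl fun w _ => ?_
      rw [← ih]
      congr 2
      funext h
      congr 2
      all_goals
        funext x
        simp [Pi.single_apply]

theorem distSum_equiv (e : W ≃ W') (p : (W → Multiset X) → A) :
    distSum (fun h : W' → Multiset X => p (h ∘ e)) = distSum p := by
  refine LinearMap.ext fun u => ?_
  induction u using polynomial_induction generalizing p with
  | one => rw [distSum_one, distSum_one]; rfl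
  | smul c u ih => simp only [map_smul, ih]
  | add u v hu hv => simp only [map_add, hu, hv]
  | X_mul b u ih =>
    rw [distSum_X_mul, distSum_X_mul, ← e.sum_comp]
    refine Finset.sum_congr rfl fun w _ => ?_
    rw [← ih]
    congr 2
    funext h
    congr 1
    funext x
    simp [Pi.single_apply]

theorem distSum_isEmpty [IsEmpty W] :
    distSum (fun _ : W → Multiset X => (1 : A)) = counit X A := by
  refine LinearMap.ext fun u => ?_
  induction u using polynomial_induction with
  | one => rw [distSum_one, counit_one]
  | smul c u ih => simp only [map_smul, ih]
  | add u v hu hv => simp only [map_add, hu, hv]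
  | X_mul b u ih => rw [distSum_X_mul, counit_X_mul, Finset.univ_eq_empty, Finset.sum_empty]

end Distribution

/-! ### Grafting onto one tree -/

/-- The number of branches at the root. -/
def RTree.rootDeg (t : RTree) : ℕ := Quot.lift PlanarTree.rootDeg (fun _ _ h => h.rootDeg_eq) t

/-- The multi-index of all vertices other than the root. -/
def RTree.phiBelow (t : RTree) : ℕ →₀ ℕ :=
  Quot.lift PlanarTree.phiBelow (fun _ _ h => h.phiBelow_eq) t

theorem RTree.phi_eq (t : RTree) : t.phi.1 = Finsupp.single t.rootDeg 1 + t.phiBelow := by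
  induction t using Quot.ind with | _ t => rfl

theorem RTree.rootDeg_adjoin (a t : RTree) : (a.adjoin t).rootDeg = t.rootDeg + 1 := by
  induction a using Quot.ind with | _ a =>
  induction t using Quot.ind with | _ t => rfl

theorem RTree.phiBelow_adjoin (a t : RTree) :
    (a.adjoin t).phiBelow = a.phi.1 + t.phiBelow := by
  induction a using Quot.ind with | _ a =>
  induction t using Quot.ind with | _ t => rfl

/-- The sum of the multi-indices of the trees of a forest. -/
def totalPhi : Multiset RTree →+ (ℕ →₀ ℕ) :=
  Multiset.sumAddMonoidHom.comp (Multiset.mapAddMonoidHom fun t : RTree => t.phi.1)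

theorem totalPhi_singleton (t : RTree) : totalPhi {t} = t.phi.1 := by
  simp [totalPhi]

theorem RTree.rootDeg_bplus (s : Multiset RTree) : (RTree.bplus s).rootDeg = s.card := by
  induction s using Multiset.induction with
  | empty => rfl
  | cons a s ih =>
    rw [RTree.bplus, Multiset.foldr_cons, ← RTree.bplus, RTree.rootDeg_adjoin, ih,
      Multiset.card_cons]

theorem RTree.phiBelow_bplus (s : Multiset RTree) : (RTree.bplus s).phiBelow = totalPhi s := by
  induction s using Multiset.induction with
  | empty => rfl
  | cons a s ih =>
    rw [RTree.bplus, Multiset.foldr_cons, ← RTree.bplus, RTree.phiBelow_adjoin, ih,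
      ← Multiset.singleton_add, map_add, totalPhi_singleton]

/-- The number of branches at a vertex of a tree to whose root `r` branches have been added. -/
def PlanarTree.outDeg : (t : PlanarTree) → ℕ → t.Vertex → ℕ
  | .bullet, r, _ => r
  | .adjoin a _, _, .inl v => a.outDeg 0 v
  | .adjoin _ t, r, .inr v => t.outDeg (r + 1) v

/-- The recursion strips branches from the root; `r` counts those already stripped, so that the root
keeps its full degree. -/
theorem PlanarTree.sum_outDeg (t : PlanarTree) (r : ℕ) (h : t.Vertex → Multiset RTree) :
    ∑ w, (Finsupp.single (t.outDeg r w + (h w).card) 1 + totalPhi (h w)) =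
      Finsupp.single (r + (t.attach h).rootDeg) 1 + (t.attach h).phiBelow := by
  induction t generalizing r with
  | bullet =>
    rw [PlanarTree.attach, RTree.rootDeg_bplus, RTree.phiBelow_bplus]
    exact Fintype.sum_unique (ι := Unit)
      fun w => Finsupp.single (r + (h w).card) 1 + totalPhi (h w)
  | adjoin a t iha iht =>
    rw [PlanarTree.attach, RTree.rootDeg_adjoin, RTree.phiBelow_adjoin, RTree.phi_eq]
    have h1 := iha 0 fun v => h (Sum.inl v)
    have h2 := iht (r + 1) fun v => h (Sum.inr v)
    rw [zero_add] at h1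
    refine (Fintype.sum_sum_type (α₁ := a.Vertex) (α₂ := t.Vertex) fun w =>
      Finsupp.single ((PlanarTree.adjoin a t).outDeg r w + (h w).card) 1 + totalPhi (h w)).trans ?_
    refine (congrArg₂ (· + ·) h1 h2).trans ?_
    rw [add_right_comm r 1, add_assoc r]
    abel

theorem PlanarTree.attach_zero (t : PlanarTree) : t.attach 0 = RTree.mk t := by
  induction t with
  | bullet => rfl
  | adjoin a t iha iht => exact congrArg₂ RTree.adjoin iha iht

theorem PlanarTree.phi_attach (t : PlanarTree) (h : t.Vertex → Multiset RTree) :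
    (t.attach h).phi.1 =
      ∑ w, (Finsupp.single (t.outDeg 0 w + (h w).card) 1 + totalPhi (h w)) := by
  rw [RTree.phi_eq, PlanarTree.sum_outDeg, zero_add]

theorem PlanarTree.phi_mk (t : PlanarTree) :
    (RTree.mk t).phi.1 = ∑ w, Finsupp.single (t.outDeg 0 w) 1 := by
  rw [← t.attach_zero, t.phi_attach]
  simp

theorem raise_prod_X {W : Type} (s : Finset W) (d : W → ℕ) :
    raise (∏ w ∈ s, MvPolynomial.X (d w)) =
      ∑ w ∈ s, ∏ w' ∈ s, MvPolynomial.X (d w' + Pi.single (M := fun _ => ℕ) w 1 w') := by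
  induction s using Finset.induction_on with
  | empty => simp
  | insert a s ha ih =>
    have h1 : ∏ w ∈ s, MvPolynomial.X (R := ℝ) (d w + Pi.single (M := fun _ => ℕ) a 1 w) =
        ∏ w ∈ s, MvPolynomial.X (d w) := Finset.prod_congr rfl fun w hw => by
      rw [Pi.single_eq_of_ne (ne_of_mem_of_not_mem hw ha), add_zero]
    rw [Finset.prod_insert ha, Derivation.leibniz, ih, Finset.sum_insert ha, Finset.prod_insert ha,
      h1, raise_X, smul_eq_mul, smul_eq_mul, Pi.single_eq_same, add_comm, mul_comm, Finset.mul_sum]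
    congr 1
    refine Finset.sum_congr rfl fun w hw => ?_
    rw [Finset.prod_insert ha, Pi.single_eq_of_ne (ne_of_mem_of_not_mem hw ha).symm, add_zero]

theorem insertion_sum {ι : Type} (s : Finset ι) (p : ι → MvPolynomial ℕ ℝ) (u : HM) :
    insertion (∑ i ∈ s, p i) u = ∑ i ∈ s, insertion (p i) u := by
  have : insertion (∑ i ∈ s, p i) = ∑ i ∈ s, insertion (p i) := linearMap_ext_monomial fun F => by
    rw [LinearMap.sum_apply, insertion_monomial, map_sum, Finset.mul_sum]
    exact Finset.sum_congr rfl fun i _ => (insertion_monomial _ _).symm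
  rw [this, LinearMap.sum_apply]

theorem Phi_X_mul (t : RTree) (u : HBCK) :
    Phi (MvPolynomial.X t * u) = MvPolynomial.X t.phi * Phi u := by
  simp [Phi]

/-- Placing one more tree at `w` raises `z_{d w}` to `z_{d w + 1}`, and the sum over `w` is the
Leibniz rule for `D`. The degrees `d` are arbitrary because the induction raises them. -/
theorem distSum_eq_insertion {W : Type} [Fintype W] (d : W → ℕ) (u : HBCK) :
    distSum (fun h : W → Multiset RTree => (∏ w, MvPolynomial.X (d w + (h w).card)) *
      MvPolynomial.monomial (∑ w, totalPhi (h w)) (1 : ℝ)) u =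
      insertion (∏ w, MvPolynomial.X (d w)) (Phi u) := by
  induction u using polynomial_induction generalizing d with
  | one => simp [distSum_one, insertion_one]
  | smul c u ih => simp only [map_smul, ih]
  | add u v hu hv => simp only [map_add, hu, hv]
  | X_mul b u ih =>
    rw [distSum_X_mul, Phi_X_mul, insertion_X_mul, raise_prod_X, insertion_sum, Finset.mul_sum]
    refine Finset.sum_congr rfl fun w _ => ?_
    rw [← ih, ← LinearMap.mulLeft_apply (R := ℝ), ← LinearMap.comp_apply, comp_distSum]
    congr 2
    funext h
    have h1 : ∀ w', ((Pi.single w {b} + h : W → Multiset RTree) w').card =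
        Pi.single (M := fun _ => ℕ) w 1 w' + (h w').card := fun w' => by
      rw [Pi.add_apply, Multiset.card_add]
      rcases eq_or_ne w' w with rfl | hw
      · simp
      · simp [hw]
    have h2 : ∑ w', totalPhi ((Pi.single w {b} + h : W → Multiset RTree) w') =
        b.phi.1 + ∑ w', totalPhi (h w') := by
      simp only [Pi.add_apply, map_add, Finset.sum_add_distrib]
      rw [Finset.sum_eq_single w (fun w' _ hw => by simp [hw]) (by simp), Pi.single_eq_same,
        totalPhi_singleton]
    simp only [h1, h2, Function.comp_apply, LinearMap.mulLeft_apply, add_assoc]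
    rw [mul_left_comm, MvPolynomial.monomial_mul, one_mul]

/-- By `PlanarTree.phi_attach` the multi-index of a grafted tree depends only on what each vertex
receives, so `distSum_eq_insertion` applies with `d` the original degrees. -/
theorem Phi_distSum_attach (t : PlanarTree) (u : HBCK) :
    Phi (distSum (fun h => MvPolynomial.X (t.attach h)) u) = graftMI (RTree.mk t).phi (Phi u) := by
  have hmon : ∀ d : t.Vertex → ℕ, MvPolynomial.monomial (∑ w, Finsupp.single (d w) 1) (1 : ℝ) =
      ∏ w, MvPolynomial.X (d w) := fun d => MvPolynomial.monomial_sum_one _ _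
  rw [graftMI, LinearMap.comp_apply, PlanarTree.phi_mk, hmon, ← distSum_eq_insertion,
    ← LinearMap.comp_apply toHM, comp_distSum, ← AlgHom.toLinearMap_apply,
    ← LinearMap.comp_apply, comp_distSum]
  congr 2
  funext h
  rw [Function.comp_apply, Function.comp_apply, ← hmon, MvPolynomial.monomial_mul, one_mul,
    ← Finset.sum_add_distrib, ← t.phi_attach, toHM_monomial, dif_pos (t.attach h).phi.2]
  simp [Phi]

/-! ### Grafting onto a forest -/

/-- The forest obtained by connecting the trees of `h ⟨j, w⟩` to the vertex `w` of `τ j`. -/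
def forestAttach {κ : Type} [Fintype κ] (τ : κ → PlanarTree)
    (h : (Σ j, (τ j).Vertex) → Multiset RTree) : HBCK :=
  ∏ j, MvPolynomial.X ((τ j).attach fun w => h ⟨j, w⟩)

/-- A disjoint union over `Option κ`, with the summand of `none` split off. -/
def sigmaOption {κ : Type} (V : Option κ → Type) : V none ⊕ (Σ j, V (some j)) ≃ Σ j, V j where
  toFun := Sum.elim (fun w => ⟨none, w⟩) fun x => ⟨some x.1, x.2⟩
  invFun
    | ⟨none, w⟩ => .inl w
    | ⟨some j, w⟩ => .inr ⟨j, w⟩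
  left_inv := by rintro (w | ⟨j, w⟩) <;> rfl
  right_inv := by rintro ⟨_ | j, w⟩ <;> rfl

/-- The vertices of the forest are those of one tree together with those of the others, so
`distSum_sum` splits the grafting. -/
theorem distSum_forestAttach_option {κ : Type} [Fintype κ] (τ : Option κ → PlanarTree) :
    distSum (forestAttach τ) = conv (distSum fun h => MvPolynomial.X ((τ none).attach h))
      (distSum (forestAttach fun j => τ (some j))) := by
  rw [← distSum_sum, ← distSum_equiv (sigmaOption fun j => (τ j).Vertex)]
  congr 1
  funext h
  rw [forestAttach, Fintype.prod_option]
  rfl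

theorem distSum_forestAttach_equiv {κ κ' : Type} [Fintype κ] [Fintype κ'] (e : κ ≃ κ')
    (τ : κ' → PlanarTree) :
    distSum (forestAttach τ) = distSum (forestAttach fun j => τ (e j)) := by
  rw [← distSum_equiv (Equiv.sigmaCongrLeft (β := fun j => (τ j).Vertex) e)]
  congr 1
  funext h
  rw [forestAttach, ← e.prod_comp]
  rfl

/-- Induction on the number of trees: left commutativity brings the convolution factor of one tree
in front of the identity, and `Φ` commutes with unshuffling. What results is the recursion
`starM_X_mul`. -/
theorem Phi_conv_distSum_forestAttach {κ : Type} [Fintype κ] (τ : κ → PlanarTree) (u : HBCK) :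
    Phi (conv LinearMap.id (distSum (forestAttach τ)) u) =
      starM (Phi u) (∏ j, MvPolynomial.X (RTree.mk (τ j)).phi) := by
  refine Fintype.induction_empty_option (P := fun κ _ => ∀ (τ : κ → PlanarTree) (u : HBCK),
    Phi (conv LinearMap.id (distSum (forestAttach τ)) u) =
      starM (Phi u) (∏ j, MvPolynomial.X (RTree.mk (τ j)).phi)) ?_ ?_ ?_ κ τ u
  · intro α β _ e ih τ u
    let _ : Fintype α := Fintype.ofEquiv β e.symm
    rw [distSum_forestAttach_equiv e, ← e.prod_comp]
    convert ih (fun j => τ (e j)) u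
  · intro τ u
    have : forestAttach τ = fun _ => 1 := funext fun h => by simp [forestAttach]
    rw [this, distSum_isEmpty, conv_counit]
    simp [starM_one]
  · intro κ _ ih τ u
    have h1 : Phi.toLinearMap ∘ₗ distSum (fun h => MvPolynomial.X ((τ none).attach h)) =
        graftMI (RTree.mk (τ none)).phi ∘ₗ Phi.toLinearMap :=
      LinearMap.ext fun u => Phi_distSum_attach (τ none) u
    have h2 : Phi.toLinearMap ∘ₗ
        conv LinearMap.id (distSum (forestAttach fun j => τ (some j))) =
        starM.flip (∏ j, MvPolynomial.X (RTree.mk (τ (some j))).phi) ∘ₗ Phi.toLinearMap :=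
      LinearMap.ext fun u => ih (fun j => τ (some j)) u
    rw [distSum_forestAttach_option, conv_left_comm, ← AlgHom.toLinearMap_apply,
      ← LinearMap.comp_apply, algHom_comp_conv, h1, h2, Fintype.prod_option, starM_X_mul]
    exact DFunLike.congr_fun (conv_comp_rename RTree.phi _ _).symm u

theorem monomial_eq_prod {σ : Type} (F : σ →₀ ℕ) : MvPolynomial.monomial F (1 : ℝ) =
    ∏ i : Finsupp.toMultiset F, MvPolynomial.X i.1 := by
  rw [MvPolynomial.monomial_eq, map_one, one_mul,
    Finset.prod_eq_multiset_prod, Multiset.map_univ (Finsupp.toMultiset F) MvPolynomial.X,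
    Finsupp.toMultiset_map, Finsupp.prod_toMultiset,
    Finsupp.prod_mapDomain_index (by simp) (by intros; rw [pow_add])]

/-- Writing a forest as a product over its occurrences turns the sum over maps in `simGraft` into
that of `distSum_prod`. -/
theorem graftBCK_monomial (G : RTree →₀ ℕ) : graftBCK.flip (MvPolynomial.monomial G 1) =
    distSum (forestAttach fun j : Finsupp.toMultiset G => Quot.out j.1) :=
  linearMap_ext_monomial fun F => by
    rw [LinearMap.flip_apply, graftBCK, constr_monomial, constr_monomial, monomial_eq_prod F,
      distSum_prod]
    simp only [simGraft, forestAttach]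

/-- The map `Φ` is compatible with the products. -/
theorem Phi_starBCK (u v : HBCK) : Phi (starBCK u v) = starM (Phi u) (Phi v) := by
  have hstar : ∀ v, starBCK u v = conv LinearMap.id (graftBCK.flip v) u := fun _ => rfl
  simp only [hstar, conv_apply]
  induction v using MvPolynomial.induction_on' with
  | monomial G a =>
    rw [← mul_one a, ← smul_eq_mul, ← MvPolynomial.smul_monomial, map_smul, map_smul, map_smul,
      TensorProduct.map_smul_right, LinearMap.smul_apply, map_smul, map_smul]
    congr 1
    rw [← conv_apply, graftBCK_monomial, Phi_conv_distSum_forestAttach, monomial_eq_prod G,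
      map_prod Phi]
    congr 1
    refine Finset.prod_congr rfl fun j _ => ?_
    rw [show RTree.mk (Quot.out j.1) = j.1 from Quot.out_eq j.1]
    simp [Phi]
  | add p q hp hq =>
    rw [map_add, map_add, map_add, TensorProduct.map_add_right, LinearMap.add_apply, map_add,
      map_add, hp, hq]

end

end MultiIndexFlow

theorem mainTheorem3 :
    -- the product and the coproduct on the graded dual are dual to `coproductM` and to the
    -- forest product
    ((∀ u v h : HM, pairM (starM u v) h = pairM₂ (u ⊗ₜ v) (coproductM h)) ∧
      (∀ u h k : HM, pairM₂ (unshuffle PopMI u) (h ⊗ₜ k) = pairM u (h * k))) ∧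
    -- `Φ` is a morphism between the dual Hopf algebras
    (Phi 1 = 1 ∧
      (∀ u v : HBCK, Phi (starBCK u v) = starM (Phi u) (Phi v)) ∧
      (∀ u : HBCK, MvPolynomial.constantCoeff (Phi u) = MvPolynomial.constantCoeff u) ∧
      (∀ u : HBCK, unshuffle PopMI (Phi u) =
        TensorProduct.map Phi.toLinearMap Phi.toLinearMap (unshuffle RTree u))) ∧
    ∀ f : ℝ → ℝ, ContDiff ℝ ∞ f →
      -- compatibility of the elementary differentials with `Φ`
      (∀ τ : RTree, elemMI f τ.phi = elemTree f τ) ∧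
      -- elementary vector fields map smooth functions to smooth functions
      (∀ (u : HM) (φ : ℝ → ℝ), ContDiff ℝ ∞ φ → ContDiff ℝ ∞ (elemField f φ u)) ∧
      -- composition
      (∀ (u v : HM) (φ : ℝ → ℝ), ContDiff ℝ ∞ φ →
        elemField f φ (starM u v) = elemField f (elemField f φ v) u) ∧
      -- Leibniz rule
      (∀ (u : HM) (φ ψ : ℝ → ℝ), ContDiff ℝ ∞ φ → ContDiff ℝ ∞ ψ →
        elemField₂ f φ ψ (unshuffle PopMI u) = elemField f (φ * ψ) u) := by
  refine ⟨⟨pairM_starM, pairM₂_unshuffle⟩,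
    ⟨map_one _, Phi_starBCK, MvPolynomial.constantCoeff_rename _, unshuffle_rename _⟩,
    fun f hf => ⟨elemMI_phi f, fun u φ hφ => contDiff_elemField hf hφ u,
      fun u v φ hφ => elemField_starM hf hφ u v, fun u φ ψ hφ hψ => conv_elemField hφ hψ u⟩⟩
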